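/- **Theorem 1 (Efficient algorithm).** Let $p,T\ge 0$ be integers, let $F_0,\dots,F_T\in\mathbb{R}^p$ be given vectors (the values $\widetilde F^*(\widehat\mu_t)$ of an approximate backward mapping) and let $\lambda_0,\dots,\lambda_T\ge 0$. For $q\in\{0\}\cup[1,\infty)$ and $\gamma\in[0,1]$ let ProxGL be the problem $$\min_{\theta_0,\dots,\theta_T\in\mathbb{R}^p}\ \gamma\sum_{t=0}^T\|\theta_t\|_0+(1-\gamma)\sum_{t=1}^T\|\theta_t-\theta_{t-1}\|_q^q\quad\text{subject to}\quad \|\theta_t-F_t\|_\infty\le\lambda_t,\ t=0,\dots,T,$$ where $\|v\|_0$ is the number of nonzero entries of $v$, $\|v\|_q^q=\sum_{i}|v_i|^q$ for $q\ge 1$, and $\|v\|_q^q$ is read as $\|v\|_0$ for $q=0$. There are one algorithm and one constant $C$, independent of $p,T,q,F,\lambda$, such that for all $p$, $T$, $q$, $F$, $\lambda$ as above the algorithm computes an entire solution path of ProxGL over all $\gamma\in[0,1]$ in at most $C\,pT^3$ elementary operations, where $p$ and $T$ are replaced by $1$ if they are $0$. Here an algorithm is a program for a sequential (single-thread) random access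 machine with exact real arithmetic: addition, subtraction, multiplication, division and comparison of reals, evaluation of the scalar penalty $x\mapsto|x|^q$ (for $q=0$: $x\mapsto 1$ if $x\ne 0$ and $0$ if $x=0$), addition, truncated subtraction and comparison of natural-number indices, conversion of an index to a real, and access to a memory cell each cost one operation. The inputs are $p,T,F,\lambda$. The path is output coordinate by coordinate: for each coordinate $i$ a number $m_i$ of pieces, breakpoints $0=g_{i,0}\le g_{i,1}\le\dots\le g_{i,m_i}=1$ and trajectories $x_{i,j}\in\mathbb{R}^{T+1}$, $0\le j<m_i$, such that for every $\gamma\in[0,1]$ and every choice of indices $j_i<m_i$ with $g_{i,j_i}\le\gamma\le g_{i,j_i+1}$, the sequence with entries $\theta_{t;i}=(x_{i,j_i})_t$ is an optimal solution of ProxGL at $\gamma$. -/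

import Mathlib

/-! ### The optimization problem -/

namespace ProxGL

/-- The number of nonzero entries of a vector. -/
noncomputable def l0norm {p : ℕ} (v : Fin p → ℝ) : ℕ :=
  (Finset.univ.filter (fun i => v i ≠ 0)).card

/-- The temporal regularizer of a vector: the `q`-th power of the `q`-norm for `q ≠ 0`,
and the number of nonzero entries for `q = 0`. -/
noncomputable def lqPow {p : ℕ} (q : ℝ) (v : Fin p → ℝ) : ℝ :=
  if q = 0 then (l0norm v : ℝ) else ∑ i, |v i| ^ q

/-- The objective; `θ t i` is coordinate `i` of the parameter at time `t = 0, …, T`. -/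
noncomputable def objective {p T : ℕ} (q γ : ℝ) (θ : Fin (T + 1) → Fin p → ℝ) : ℝ :=
  γ * ∑ t, (l0norm (θ t) : ℝ) + (1 - γ) * ∑ t : Fin T, lqPow q (θ t.succ - θ t.castSucc)

/-- The feasible set: the sup-norm ball of radius `lam t` around `F t` at each time `t`, where
`F t` is the approximate backward mapping at time `t`. -/
def feasible {p T : ℕ} (F : Fin (T + 1) → Fin p → ℝ) (lam : Fin (T + 1) → ℝ) :
    Set (Fin (T + 1) → Fin p → ℝ) :=
  {θ | ∀ t, ‖θ t - F t‖ ≤ lam t}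

/-- `θ` is an optimal solution at the parameter `γ`. -/
def IsSolution {p T : ℕ} (q γ : ℝ) (F : Fin (T + 1) → Fin p → ℝ) (lam : Fin (T + 1) → ℝ)
    (θ : Fin (T + 1) → Fin p → ℝ) : Prop :=
  θ ∈ feasible F lam ∧ IsMinOn (objective q γ) (feasible F lam) θ

/-- A complete description of a solution path over `γ ∈ [0,1]`, coordinate by coordinate.
Coordinate `i` has `m i` pieces; piece `j < m i` is the interval `[g i j, g i (j + 1)]` of values
of `γ`, and on it the coordinate follows the trajectory `t ↦ x i j t`. The pieces of each
coordinate cover `[0,1]`, and for every `γ ∈ [0,1]` putting together, for each coordinate, the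
trajectory of a piece that contains `γ` gives an optimal solution. -/
structure IsSolutionPath {p T : ℕ} (q : ℝ) (F : Fin (T + 1) → Fin p → ℝ)
    (lam : Fin (T + 1) → ℝ) (m : Fin p → ℕ) (g : Fin p → ℕ → ℝ)
    (x : Fin p → ℕ → Fin (T + 1) → ℝ) : Prop where
  first : ∀ i, g i 0 = 0
  last : ∀ i, g i (m i) = 1
  mono : ∀ i, ∀ j < m i, g i j ≤ g i (j + 1)
  optimal : ∀ γ ∈ Set.Icc (0 : ℝ) 1, ∀ J : Fin p → ℕ,
    (∀ i, J i < m i ∧ g i (J i) ≤ γ ∧ γ ≤ g i (J i + 1)) →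
      IsSolution q γ F lam (fun t i => x i (J i) t)

end ProxGL

/-! ### The machine: a sequential real RAM with unit costs

The memory consists of index variables and index arrays (natural numbers), and of real variables
and real arrays. Arrays have up to three indices: the cell `(a, i, j, k)` is the entry `(i, j, k)`
of the array `a`. Indices can be added, subtracted (truncated at zero) and compared; reals can be
added, subtracted, multiplied, divided and compared exactly, and the scalar temporal penalty can
be evaluated. Indices can be converted to reals, but not conversely. -/

namespace RealRAM

/-- The scalar temporal penalty `|x| ^ q`, which for `q = 0` is the indicator of `x ≠ 0`. -/
noncomputable def penalty (q x : ℝ) : ℝ :=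
  if q = 0 then (if x = 0 then 0 else 1) else |x| ^ q

/-- The contents of the memory. -/
structure Store where
  nvar : ℕ → ℕ
  rvar : ℕ → ℝ
  ncell : ℕ × ℕ × ℕ × ℕ → ℕ
  rcell : ℕ × ℕ × ℕ × ℕ → ℝ

/-- Index expressions. -/
inductive NExp where
  | lit (n : ℕ)
  | var (v : ℕ)
  | get (a : ℕ) (i j k : NExp)
  | add (e₁ e₂ : NExp)
  | sub (e₁ e₂ : NExp)

/-- Real expressions; the only constants are those obtained from index expressions. -/
inductive RExp where
  | ofN (e : NExp)
  | var (v : ℕ)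
  | get (a : ℕ) (i j k : NExp)
  | add (e₁ e₂ : RExp)
  | sub (e₁ e₂ : RExp)
  | mul (e₁ e₂ : RExp)
  | div (e₁ e₂ : RExp)
  | pen (e : RExp)

/-- Tests. -/
inductive Test where
  | nle (e₁ e₂ : NExp)
  | rle (e₁ e₂ : RExp)
  | not (b : Test)
  | and (b₁ b₂ : Test)

/-- Programs. -/
inductive Prog where
  | skip
  | nset (v : ℕ) (e : NExp)
  | rset (v : ℕ) (e : RExp)
  | nput (a : ℕ) (i j k e : NExp)
  | rput (a : ℕ) (i j k : NExp) (e : RExp)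
  | seq (P₁ P₂ : Prog)
  | ite (b : Test) (P₁ P₂ : Prog)
  | loop (b : Test) (P : Prog)

def NExp.eval (s : Store) : NExp → ℕ
  | .lit n => n
  | .var v => s.nvar v
  | .get a i j k => s.ncell (a, i.eval s, j.eval s, k.eval s)
  | .add e₁ e₂ => e₁.eval s + e₂.eval s
  | .sub e₁ e₂ => e₁.eval s - e₂.eval s

noncomputable def RExp.eval (q : ℝ) (s : Store) : RExp → ℝ
  | .ofN e => (e.eval s : ℝ)
  | .var v => s.rvar v
  | .get a i j k => s.rcell (a, i.eval s, j.eval s, k.eval s)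
  | .add e₁ e₂ => e₁.eval q s + e₂.eval q s
  | .sub e₁ e₂ => e₁.eval q s - e₂.eval q s
  | .mul e₁ e₂ => e₁.eval q s * e₂.eval q s
  | .div e₁ e₂ => e₁.eval q s / e₂.eval q s
  | .pen e => penalty q (e.eval q s)

def Test.Holds (q : ℝ) (s : Store) : Test → Prop
  | .nle e₁ e₂ => e₁.eval s ≤ e₂.eval s
  | .rle e₁ e₂ => e₁.eval q s ≤ e₂.eval q s
  | .not b => ¬ b.Holds q s
  | .and b₁ b₂ => b₁.Holds q s ∧ b₂.Holds q s

/-! The cost of an expression or a test is the number of elementary operations in it, every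
constant, memory access, arithmetic operation, comparison and connective counting one. -/

def NExp.cost : NExp → ℕ
  | .lit _ => 1
  | .var _ => 1
  | .get _ i j k => i.cost + j.cost + k.cost + 1
  | .add e₁ e₂ => e₁.cost + e₂.cost + 1
  | .sub e₁ e₂ => e₁.cost + e₂.cost + 1

def RExp.cost : RExp → ℕ
  | .ofN e => e.cost + 1
  | .var _ => 1
  | .get _ i j k => i.cost + j.cost + k.cost + 1
  | .add e₁ e₂ => e₁.cost + e₂.cost + 1
  | .sub e₁ e₂ => e₁.cost + e₂.cost + 1
  | .mul e₁ e₂ => e₁.cost + e₂.cost + 1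
  | .div e₁ e₂ => e₁.cost + e₂.cost + 1
  | .pen e => e.cost + 1

def Test.cost : Test → ℕ
  | .nle e₁ e₂ => e₁.cost + e₂.cost + 1
  | .rle e₁ e₂ => e₁.cost + e₂.cost + 1
  | .not b => b.cost + 1
  | .and b₁ b₂ => b₁.cost + b₂.cost + 1

/-- `Exec q P s n s'`: the program `P`, started in the memory `s`, halts after `n` elementary
operations in the memory `s'`. -/
inductive Exec (q : ℝ) : Prog → Store → ℕ → Store → Prop where
  | skip (s : Store) : Exec q .skip s 1 s
  | nset (v : ℕ) (e : NExp) (s : Store) :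
      Exec q (.nset v e) s (e.cost + 1) { s with nvar := Function.update s.nvar v (e.eval s) }
  | rset (v : ℕ) (e : RExp) (s : Store) :
      Exec q (.rset v e) s (e.cost + 1) { s with rvar := Function.update s.rvar v (e.eval q s) }
  | nput (a : ℕ) (i j k e : NExp) (s : Store) :
      Exec q (.nput a i j k e) s (i.cost + j.cost + k.cost + e.cost + 1)
        { s with ncell :=
          Function.update s.ncell (a, i.eval s, j.eval s, k.eval s) (e.eval s) }
  | rput (a : ℕ) (i j k : NExp) (e : RExp) (s : Store) :
      Exec q (.rput a i j k e) s (i.cost + j.cost + k.cost + e.cost + 1)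
        { s with rcell :=
          Function.update s.rcell (a, i.eval s, j.eval s, k.eval s) (e.eval q s) }
  | seq {P₁ P₂ : Prog} {s₁ s₂ s₃ : Store} {n₁ n₂ : ℕ} (h₁ : Exec q P₁ s₁ n₁ s₂)
      (h₂ : Exec q P₂ s₂ n₂ s₃) : Exec q (.seq P₁ P₂) s₁ (n₁ + n₂) s₃
  | iteTrue {b : Test} {P₁ P₂ : Prog} {s₁ s₂ : Store} {n : ℕ} (hb : b.Holds q s₁)
      (h : Exec q P₁ s₁ n s₂) : Exec q (.ite b P₁ P₂) s₁ (b.cost + n) s₂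
  | iteFalse {b : Test} {P₁ P₂ : Prog} {s₁ s₂ : Store} {n : ℕ} (hb : ¬ b.Holds q s₁)
      (h : Exec q P₂ s₁ n s₂) : Exec q (.ite b P₁ P₂) s₁ (b.cost + n) s₂
  | loopTrue {b : Test} {P : Prog} {s₁ s₂ s₃ : Store} {n₁ n₂ : ℕ} (hb : b.Holds q s₁)
      (h₁ : Exec q P s₁ n₁ s₂) (h₂ : Exec q (.loop b P) s₂ n₂ s₃) :
      Exec q (.loop b P) s₁ (b.cost + n₁ + n₂) s₃
  | loopFalse {b : Test} {P : Prog} {s : Store} (hb : ¬ b.Holds q s) :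
      Exec q (.loop b P) s b.cost s

end RealRAM

/-! ### Input and output conventions -/

namespace ProxGL

/-- The initial memory: `p` and `T` in the index variables `0` and `1`, the centres `F` in the
real array `0`, the radii `lam` in the real array `1`, and zero everywhere else. -/
noncomputable def input {p T : ℕ} (F : Fin (T + 1) → Fin p → ℝ) (lam : Fin (T + 1) → ℝ) :
    RealRAM.Store where
  nvar v := if v = 0 then p else if v = 1 then T else 0
  rvar _ := 0
  ncell _ := 0
  rcell
    | (0, t, i, 0) => if h : t < T + 1 ∧ i < p then F ⟨t, h.1⟩ ⟨i, h.2⟩ else 0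
    | (1, t, 0, 0) => if h : t < T + 1 then lam ⟨t, h⟩ else 0
    | _ => 0

/-- The numbers of pieces that a final memory holds, in the index array `0`. -/
def outPieces (p : ℕ) (s : RealRAM.Store) (i : Fin p) : ℕ := s.ncell (0, i, 0, 0)

/-- The breakpoints that a final memory holds, in the real array `2`. -/
def outBreaks (p : ℕ) (s : RealRAM.Store) (i : Fin p) (j : ℕ) : ℝ := s.rcell (2, i, j, 0)

/-- The trajectories that a final memory holds, in the real array `3`. -/
def outValues (p T : ℕ) (s : RealRAM.Store) (i : Fin p) (j : ℕ) (t : Fin (T + 1)) : ℝ :=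
  s.rcell (3, i, j, t)

end ProxGL

namespace RealRAM

/-! ### Executions with syntactic cost bounds -/

/-! The objective and the constraints split over the coordinates (`objective_eq`, `feasible_iff`),
so it suffices to find a path for one coordinate in `O(T^3)` operations. For one coordinate let `W
k` be the least temporal cost of a feasible trajectory with at most `k` nonzero entries. The optimal
value at `γ` is the minimum of `γ * k + (1 - γ) * W k` over the feasible budgets `k ≤ T + 1`, a
lower envelope of at most `T + 2` lines. As `W` is nonincreasing, the envelope can be traced from `γ
= 0` by always passing to the smaller budget whose line is met first (`Front.next`).

All `W k` come from one shortest path computation with three nodes per time. For `q ≥ 1`, an optimal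
trajectory can be chosen affine between the times at which it is zero or on one of its bounds, and
constant before the first and after the last of them (`exists_smooth`): moving a free value towards
its neighbours does not increase a convex cost. Such a trajectory is a path, a node recording the
time and which of the three values is taken. For `q = 0` the pieces are constant blocks; a nonzero
block can take the maximum of its lower bounds as its value, and a run of zeros is cut into single
entries, so that the same graph serves. An edge charges every entry of its piece as nonzero, except
a final zero. This may overcount for some paths, but not for one that has a node at every zero of
its trajectory.

Two facts link table and problem. `Table.sound`: a stored trajectory is feasible, respects its
budget and costs at most the stored value. `Table.complete`: every feasible trajectory costs at
least the value stored for its number of nonzero entries. Together they give optimality of the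
envelope (`Table.optimalOn`).

Running time: there are `O(T^2)` edges, each tested in `O(T)`; there are `O(T^2)` pairs of node and
budget, each with `O(T)` predecessors and a trajectory of length `O(T)` to write. The program for a
coordinate thus has loops nested to depth three with at most `3 * T + 10` iterations each, and its
cost is read off from the syntax (`Prog.bound_le`). -/

def Store.setN (s : Store) (v x : ℕ) : Store := { s with nvar := Function.update s.nvar v x }
noncomputable def Store.setR (s : Store) (v : ℕ) (x : ℝ) : Store :=
  { s with rvar := Function.update s.rvar v x }
def Store.putN (s : Store) (c : ℕ × ℕ × ℕ × ℕ) (x : ℕ) : Store :=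
  { s with ncell := Function.update s.ncell c x }
noncomputable def Store.putR (s : Store) (c : ℕ × ℕ × ℕ × ℕ) (x : ℝ) : Store :=
  { s with rcell := Function.update s.rcell c x }

section
variable (s : Store) (v w x : ℕ) (y : ℝ) (c d : ℕ × ℕ × ℕ × ℕ)
@[simp] theorem Store.setN_nvar : (s.setN v x).nvar w = if w = v then x else s.nvar w := by
  simp [Store.setN, Function.update_apply]
@[simp] theorem Store.setN_rvar : (s.setN v x).rvar = s.rvar := rfl
@[simp] theorem Store.setN_ncell : (s.setN v x).ncell = s.ncell := rfl
@[simp] theorem Store.setN_rcell : (s.setN v x).rcell = s.rcell := rfl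
@[simp] theorem Store.setR_rvar : (s.setR v y).rvar w = if w = v then y else s.rvar w := by
  simp [Store.setR, Function.update_apply]
@[simp] theorem Store.setR_nvar : (s.setR v y).nvar = s.nvar := rfl
@[simp] theorem Store.setR_ncell : (s.setR v y).ncell = s.ncell := rfl
@[simp] theorem Store.setR_rcell : (s.setR v y).rcell = s.rcell := rfl
@[simp] theorem Store.putN_ncell : (s.putN c x).ncell d = if d = c then x else s.ncell d := by
  simp [Store.putN, Function.update_apply]
@[simp] theorem Store.putN_nvar : (s.putN c x).nvar = s.nvar := rfl
@[simp] theorem Store.putN_rvar : (s.putN c x).rvar = s.rvar := rfl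
@[simp] theorem Store.putN_rcell : (s.putN c x).rcell = s.rcell := rfl
@[simp] theorem Store.putR_rcell : (s.putR c y).rcell d = if d = c then y else s.rcell d := by
  simp [Store.putR, Function.update_apply]
@[simp] theorem Store.putR_nvar : (s.putR c y).nvar = s.nvar := rfl
@[simp] theorem Store.putR_rvar : (s.putR c y).rvar = s.rvar := rfl
@[simp] theorem Store.putR_ncell : (s.putR c y).ncell = s.ncell := rfl
end

/-- A bound for the cost of a program in which every loop makes at most `N` iterations. -/
def Prog.bound (N : ℕ) : Prog → ℕ
  | .skip => 1
  | .nset _ e => e.cost + 1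
  | .rset _ e => e.cost + 1
  | .nput _ i j k e => i.cost + j.cost + k.cost + e.cost + 1
  | .rput _ i j k e => i.cost + j.cost + k.cost + e.cost + 1
  | .seq P₁ P₂ => P₁.bound N + P₂.bound N
  | .ite b P₁ P₂ => b.cost + (P₁.bound N + P₂.bound N)
  | .loop b P => (N + 1) * (b.cost + P.bound N)

/-- The nesting depth of the loops of a program. -/
def Prog.depth : Prog → ℕ
  | .seq P₁ P₂ => max P₁.depth P₂.depth
  | .ite _ P₁ P₂ => max P₁.depth P₂.depth
  | .loop _ P => P.depth + 1
  | _ => 0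

/-- A loop costs the factor `N + 1 ≤ 2 * N`, and the 2 is the factor that it has in the bound for `N
= 1`. So the constant of the theorem is the bound for one iteration per loop, and the exponent is
the nesting depth. -/
theorem Prog.bound_le {N : ℕ} (hN : 1 ≤ N) (P : Prog) :
    P.bound N ≤ P.bound 1 * N ^ P.depth := by
  have two (a b c d : ℕ) : a * N ^ c + b * N ^ d ≤ (a + b) * N ^ max c d := by
    have h₁ : N ^ c ≤ N ^ max c d := Nat.pow_le_pow_right hN (le_max_left _ _)
    have h₂ : N ^ d ≤ N ^ max c d := Nat.pow_le_pow_right hN (le_max_right _ _)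
    nlinarith [Nat.mul_le_mul_left a h₁, Nat.mul_le_mul_left b h₂]
  induction P with
  | seq P₁ P₂ h₁ h₂ =>
    simp only [bound, depth]
    exact (Nat.add_le_add h₁ h₂).trans (two _ _ _ _)
  | ite b P₁ P₂ h₁ h₂ =>
    simp only [bound, depth]
    have h₃ := (Nat.add_le_add h₁ h₂).trans (two _ _ _ _)
    have h₄ : b.cost ≤ b.cost * N ^ max P₁.depth P₂.depth :=
      Nat.le_mul_of_pos_right _ (Nat.pow_pos hN)
    rw [Nat.add_mul]
    exact Nat.add_le_add h₄ h₃
  | loop b P h =>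
    simp only [bound, depth]
    have h₄ : b.cost ≤ b.cost * N ^ P.depth := Nat.le_mul_of_pos_right _ (Nat.pow_pos hN)
    calc (N + 1) * (b.cost + P.bound N)
        ≤ (N + N) * (b.cost * N ^ P.depth + P.bound 1 * N ^ P.depth) :=
          Nat.mul_le_mul (by omega) (Nat.add_le_add h₄ h)
      _ = (1 + 1) * (b.cost + P.bound 1) * N ^ (P.depth + 1) := by ring
  | _ => simp [bound, depth]

/-! Syntactic tests for the memory that a program may modify. -/

def Prog.modN (v : ℕ) : Prog → Bool
  | .nset w _ => w == v
  | .seq P₁ P₂ => P₁.modN v || P₂.modN v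
  | .ite _ P₁ P₂ => P₁.modN v || P₂.modN v
  | .loop _ P => P.modN v
  | _ => false

def Prog.modR (v : ℕ) : Prog → Bool
  | .rset w _ => w == v
  | .seq P₁ P₂ => P₁.modR v || P₂.modR v
  | .ite _ P₁ P₂ => P₁.modR v || P₂.modR v
  | .loop _ P => P.modR v
  | _ => false

def Prog.modNC (a : ℕ) : Prog → Bool
  | .nput b _ _ _ _ => b == a
  | .seq P₁ P₂ => P₁.modNC a || P₂.modNC a
  | .ite _ P₁ P₂ => P₁.modNC a || P₂.modNC a
  | .loop _ P => P.modNC a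
  | _ => false

def Prog.modRC (a : ℕ) : Prog → Bool
  | .rput b _ _ _ _ => b == a
  | .seq P₁ P₂ => P₁.modRC a || P₂.modRC a
  | .ite _ P₁ P₂ => P₁.modRC a || P₂.modRC a
  | .loop _ P => P.modRC a
  | _ => false

/-- Two stores agree on all the memory that a program does not modify. -/
structure Frame (P : Prog) (s s' : Store) : Prop where
  n : ∀ v, P.modN v = false → s'.nvar v = s.nvar v
  r : ∀ v, P.modR v = false → s'.rvar v = s.rvar v
  nc : ∀ a, P.modNC a = false → ∀ x, s'.ncell (a, x) = s.ncell (a, x)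
  rc : ∀ a, P.modRC a = false → ∀ x, s'.rcell (a, x) = s.rcell (a, x)

theorem Frame.refl (P : Prog) (s : Store) : Frame P s s :=
  ⟨fun _ _ => rfl, fun _ _ => rfl, fun _ _ _ => rfl, fun _ _ _ => rfl⟩

theorem Frame.trans {P : Prog} {s₁ s₂ s₃ : Store} (h : Frame P s₁ s₂) (h' : Frame P s₂ s₃) :
    Frame P s₁ s₃ :=
  ⟨fun v hv => (h'.n v hv).trans (h.n v hv), fun v hv => (h'.r v hv).trans (h.r v hv),
    fun a ha x => (h'.nc a ha x).trans (h.nc a ha x),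
    fun a ha x => (h'.rc a ha x).trans (h.rc a ha x)⟩

theorem Frame.mono {P P' : Prog} {s s' : Store} (h : Frame P s s')
    (hn : ∀ v, P'.modN v = false → P.modN v = false)
    (hr : ∀ v, P'.modR v = false → P.modR v = false)
    (hnc : ∀ v, P'.modNC v = false → P.modNC v = false)
    (hrc : ∀ v, P'.modRC v = false → P.modRC v = false) : Frame P' s s' :=
  ⟨fun v hv => h.n v (hn v hv), fun v hv => h.r v (hr v hv),
    fun a ha => h.nc a (hnc a ha), fun a ha => h.rc a (hrc a ha)⟩

/-- The sets of modified memory are computed from the syntax, so for a concrete program every claim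
that something is left unchanged reduces to `rfl`. -/
theorem Exec.frame {q : ℝ} {P : Prog} {s s' : Store} {n : ℕ} (h : Exec q P s n s') :
    Frame P s s' := by
  induction h with
  | skip s => exact Frame.refl _ _
  | nset v e s =>
    refine ⟨fun w hw => ?_, fun _ _ => rfl, fun _ _ _ => rfl, fun _ _ _ => rfl⟩
    simp only [Prog.modN, beq_eq_false_iff_ne] at hw
    exact Function.update_of_ne (Ne.symm hw) _ _
  | rset v e s =>
    refine ⟨fun _ _ => rfl, fun w hw => ?_, fun _ _ _ => rfl, fun _ _ _ => rfl⟩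
    simp only [Prog.modR, beq_eq_false_iff_ne] at hw
    exact Function.update_of_ne (Ne.symm hw) _ _
  | nput a i j k e s =>
    refine ⟨fun _ _ => rfl, fun _ _ => rfl, fun b hb x => ?_, fun _ _ _ => rfl⟩
    simp only [Prog.modNC, beq_eq_false_iff_ne] at hb
    exact Function.update_of_ne (fun h => hb (congrArg Prod.fst h).symm) _ _
  | rput a i j k e s =>
    refine ⟨fun _ _ => rfl, fun _ _ => rfl, fun _ _ _ => rfl, fun b hb x => ?_⟩
    simp only [Prog.modRC, beq_eq_false_iff_ne] at hb
    exact Function.update_of_ne (fun h => hb (congrArg Prod.fst h).symm) _ _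
  | seq h₁ h₂ ih₁ ih₂ =>
    refine Frame.trans (ih₁.mono ?_ ?_ ?_ ?_) (ih₂.mono ?_ ?_ ?_ ?_) <;>
      simp +contextual [Prog.modN, Prog.modR, Prog.modNC, Prog.modRC]
  | iteTrue hb h ih =>
    refine ih.mono ?_ ?_ ?_ ?_ <;>
      simp +contextual [Prog.modN, Prog.modR, Prog.modNC, Prog.modRC]
  | iteFalse hb h ih =>
    refine ih.mono ?_ ?_ ?_ ?_ <;>
      simp +contextual [Prog.modN, Prog.modR, Prog.modNC, Prog.modRC]
  | loopTrue hb h₁ h₂ ih₁ ih₂ =>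
    refine Frame.trans (ih₁.mono ?_ ?_ ?_ ?_) ih₂ <;>
      simp +contextual [Prog.modN, Prog.modR, Prog.modNC, Prog.modRC]
  | loopFalse hb => exact Frame.refl _ _

/-- Started in `s`, the program halts within its cost bound in a memory that satisfies `Q`. -/
def Run (q : ℝ) (N : ℕ) (P : Prog) (s : Store) (Q : Store → Prop) : Prop :=
  ∃ n s', Exec q P s n s' ∧ n ≤ P.bound N ∧ Q s'

/-! ### Rules for total correctness with cost bounds. -/

section
variable {q : ℝ} {N : ℕ} {s : Store} {Q Q' : Store → Prop} {P P₁ P₂ : Prog}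

theorem Run.frame (h : Run q N P s Q) : Run q N P s (fun s' => Q s' ∧ Frame P s s') := by
  obtain ⟨n, s', he, hn, hQ⟩ := h
  exact ⟨n, s', he, hn, hQ, he.frame⟩

theorem Run.mono (h : Run q N P s Q) (hQ : ∀ s', Q s' → Frame P s s' → Q' s') :
    Run q N P s Q' := by
  obtain ⟨n, s', he, hn, h⟩ := h
  exact ⟨n, s', he, hn, hQ s' h he.frame⟩

theorem Run.skip (h : Q s) : Run q N .skip s Q := ⟨_, _, .skip s, le_rfl, h⟩

theorem Run.nset {v : ℕ} {e : NExp} (h : Q (s.setN v (e.eval s))) : Run q N (.nset v e) s Q :=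
  ⟨_, _, .nset v e s, le_rfl, h⟩

theorem Run.rset {v : ℕ} {e : RExp} (h : Q (s.setR v (e.eval q s))) :
    Run q N (.rset v e) s Q :=
  ⟨_, _, .rset v e s, le_rfl, h⟩

theorem Run.nput {a : ℕ} {i j k e : NExp}
    (h : Q (s.putN (a, i.eval s, j.eval s, k.eval s) (e.eval s))) :
    Run q N (.nput a i j k e) s Q :=
  ⟨_, _, .nput a i j k e s, le_rfl, h⟩

theorem Run.rput {a : ℕ} {i j k : NExp} {e : RExp}
    (h : Q (s.putR (a, i.eval s, j.eval s, k.eval s) (e.eval q s))) :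
    Run q N (.rput a i j k e) s Q :=
  ⟨_, _, .rput a i j k e s, le_rfl, h⟩

theorem Run.seq (h : Run q N P₁ s (fun s' => Run q N P₂ s' Q)) : Run q N (.seq P₁ P₂) s Q := by
  obtain ⟨n₁, s₁, h₁, hn₁, n₂, s₂, h₂, hn₂, hQ⟩ := h
  exact ⟨_, _, h₁.seq h₂, Nat.add_le_add hn₁ hn₂, hQ⟩

theorem Run.ite {b : Test} (h₁ : b.Holds q s → Run q N P₁ s Q)
    (h₂ : ¬ b.Holds q s → Run q N P₂ s Q) : Run q N (.ite b P₁ P₂) s Q := by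
  by_cases hb : b.Holds q s
  · obtain ⟨n, s', h, hn, hQ⟩ := h₁ hb
    exact ⟨_, _, .iteTrue hb h, by simp only [Prog.bound]; omega, hQ⟩
  · obtain ⟨n, s', h, hn, hQ⟩ := h₂ hb
    exact ⟨_, _, .iteFalse hb h, by simp only [Prog.bound]; omega, hQ⟩

end

/-- `for v = lo, …, hi - 1 do P`. -/
def Prog.for (v : ℕ) (lo hi : NExp) (P : Prog) : Prog :=
  .seq (.nset v lo) (.loop (.nle (.add (.var v) (.lit 1)) hi)
    (.seq P (.nset v (.add (.var v) (.lit 1)))))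

/-- Induction on the number `d` of iterations that remain. An iteration costs `hi.cost + 4` for the
test, at most `c` for the body and 4 for the increment. Frames always refer to the initial memory,
so the upper limit keeps its value throughout. -/
theorem exec_loop {q : ℝ} {v : ℕ} {hi : NExp} {P : Prog} {b c : ℕ}
    (I : ℕ → Store → Prop) (d : ℕ) (s : Store) (hd : s.nvar v + d = b) (h0 : I (s.nvar v) s)
    (hhi : ∀ s', Frame (.seq P (.nset v (.add (.var v) (.lit 1)))) s s' → hi.eval s' = b)
    (step : ∀ k s', s.nvar v ≤ k → k < b → s'.nvar v = k →
      Frame (.seq P (.nset v (.add (.var v) (.lit 1)))) s s' → I k s' →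
      ∃ n s'', Exec q P s' n s'' ∧ n ≤ c ∧ s''.nvar v = k ∧ I (k + 1) (s''.setN v (k + 1))) :
    ∃ n s', Exec q (.loop (.nle (.add (.var v) (.lit 1)) hi)
        (.seq P (.nset v (.add (.var v) (.lit 1))))) s n s' ∧
      n ≤ d * (hi.cost + c + 8) + (hi.cost + 8) ∧ I b s' := by
  induction d generalizing s with
  | zero =>
    refine ⟨_, s, .loopFalse ?_, ?_, ?_⟩
    · simp only [Test.Holds, NExp.eval, hhi s (Frame.refl _ _)]; omega
    · simp only [Test.cost, NExp.cost]; omega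
    · rw [← hd]; simpa using h0
  | succ d ih =>
    obtain ⟨n, s₁, he, hn, hv, hI⟩ := step _ s le_rfl (by omega) rfl (Frame.refl _ _) h0
    have he' : Exec q (.seq P (.nset v (.add (.var v) (.lit 1)))) s (n + 4)
        (s₁.setN v (s.nvar v + 1)) := by
      have := he.seq (Exec.nset v (.add (.var v) (.lit 1)) s₁)
      simp only [NExp.eval, hv] at this
      exact this
    have hf := he'.frame
    obtain ⟨n', s₂, he₂, hn', hI'⟩ := ih (s₁.setN v (s.nvar v + 1)) (by simp; omega)
      (by simpa using hI) (fun s' h => hhi s' (hf.trans h))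
      (fun k s' h₁ h₂ h₃ h₄ h₅ => step k s' (by simp at h₁; omega) h₂ h₃ (hf.trans h₄) h₅)
    refine ⟨_, s₂, .loopTrue ?_ he' he₂, ?_, hI'⟩
    · simp only [Test.Holds, NExp.eval, hhi s (Frame.refl _ _)]; omega
    · simp only [Test.cost, NExp.cost]
      rw [Nat.add_mul]; omega

/-- The bound is linear in the actual number of iterations. This form is needed for the loop over
the coordinates, since `p` is not bounded in terms of `T`. -/
theorem exec_for {q : ℝ} {v : ℕ} {lo hi : NExp} {P : Prog} {c : ℕ} {s : Store}
    (I : ℕ → Store → Prop) (a b : ℕ) (ha : lo.eval s = a) (hab : a ≤ b)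
    (h0 : I a (s.setN v a))
    (hhi : ∀ s', Frame (.for v lo hi P) s s' → hi.eval s' = b)
    (step : ∀ k s', a ≤ k → k < b → s'.nvar v = k → Frame (.for v lo hi P) s s' → I k s' →
      ∃ n s'', Exec q P s' n s'' ∧ n ≤ c ∧ s''.nvar v = k ∧ I (k + 1) (s''.setN v (k + 1))) :
    ∃ n s', Exec q (.for v lo hi P) s n s' ∧
      n ≤ (lo.cost + 1) + ((b - a) * (hi.cost + c + 8) + (hi.cost + 8)) ∧ I b s' := by
  have e₀ : Exec q (.nset v lo) s _ (s.setN v a) := ha ▸ Exec.nset v lo s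
  have f (s' : Store) (h : Frame (.seq P (.nset v (.add (.var v) (.lit 1)))) (s.setN v a) s') :
      Frame (.for v lo hi P) s s' := by
    refine Frame.trans (e₀.frame.mono ?_ ?_ ?_ ?_) (h.mono ?_ ?_ ?_ ?_) <;>
      simp +contextual [Prog.for, Prog.modN, Prog.modR, Prog.modNC, Prog.modRC]
  obtain ⟨n, s', he, hn, hI⟩ := exec_loop (q := q) (v := v) (hi := hi) (P := P) (b := b) (c := c)
    I (b - a) (s.setN v a) (by simp; omega) (by simpa using h0) (fun s' h => hhi s' (f s' h))
    (fun k s' h₁ h₂ h₃ h₄ h₅ => step k s' (by simpa using h₁) h₂ h₃ (f s' h₄) h₅)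
  exact ⟨_, s', e₀.seq he, by omega, hI⟩

theorem Run.for {q : ℝ} {N : ℕ} {v : ℕ} {lo hi : NExp} {P : Prog} {s : Store}
    (I : ℕ → Store → Prop) (a b : ℕ) (ha : lo.eval s = a) (hab : a ≤ b) (hN : b - a ≤ N)
    (hv : P.modN v = false) (h0 : I a (s.setN v a))
    (hhi : ∀ s', Frame (.for v lo hi P) s s' → hi.eval s' = b)
    (step : ∀ k s', a ≤ k → k < b → s'.nvar v = k → Frame (.for v lo hi P) s s' → I k s' →
      Run q N P s' (fun s'' => I (k + 1) (s''.setN v (k + 1)))) :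
    Run q N (.for v lo hi P) s (I b) := by
  obtain ⟨n, s', he, hn, hI⟩ := exec_for (q := q) (c := P.bound N) I a b ha hab h0 hhi
    (fun k s' h₁ h₂ h₃ h₄ h₅ => by
      obtain ⟨n, s'', he, hn, h⟩ := step k s' h₁ h₂ h₃ h₄ h₅
      exact ⟨n, s'', he, hn, (he.frame.n v hv).trans h₃, h⟩)
  refine ⟨n, s', he, hn.trans ?_, hI⟩
  simp only [Prog.for, Prog.bound, Test.cost, NExp.cost]
  have : (b - a) * (hi.cost + P.bound N + 8) ≤ N * (hi.cost + P.bound N + 8) :=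
    Nat.mul_le_mul_right _ hN
  nlinarith

end RealRAM

/-! ### Elementary properties of the scalar penalty. -/

open RealRAM in
theorem RealRAM.penalty_zero {q : ℝ} (hq : q = 0 ∨ 1 ≤ q) : penalty q 0 = 0 := by
  rcases hq with rfl | hq
  · simp [penalty]
  · have : q ≠ 0 := by linarith
    simp [penalty, this]

theorem RealRAM.penalty_nonneg (q x : ℝ) : 0 ≤ RealRAM.penalty q x := by
  unfold RealRAM.penalty
  split_ifs <;> positivity

theorem RealRAM.penalty_zero_le_one (x : ℝ) : RealRAM.penalty 0 x ≤ 1 := by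
  unfold RealRAM.penalty
  split_ifs <;> simp

namespace ProxGL

open RealRAM (penalty penalty_zero penalty_nonneg penalty_zero_le_one)

/-! ### The problem of one coordinate as a shortest path problem -/

/-- The problem of one coordinate, with times `1, …, T + 1`. -/
structure Scalar where
  q : ℝ
  T : ℕ
  lo : ℕ → ℝ
  hi : ℕ → ℝ

/-- The maximum of `f` over `s + 1, …, s + 1 + d`. -/
noncomputable def runMax (f : ℕ → ℝ) (s : ℕ) : ℕ → ℝ
  | 0 => f (s + 1)
  | d + 1 => max (runMax f s d) (f (s + 1 + (d + 1)))

theorem le_runMax (f : ℕ → ℝ) (s d r : ℕ) (h₁ : s < r) (h₂ : r ≤ s + 1 + d) :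
    f r ≤ runMax f s d := by
  induction d with
  | zero => rw [show r = s + 1 by omega]; exact le_rfl
  | succ d ih =>
    rcases Nat.lt_or_ge (s + 1 + d) r with h | h
    · rw [show r = s + 1 + (d + 1) by omega]; exact le_max_right _ _
    · exact (ih h).trans (le_max_left _ _)

theorem runMax_le (f : ℕ → ℝ) (s d : ℕ) (c : ℝ) (h : ∀ r, s < r → r ≤ s + 1 + d → f r ≤ c) :
    runMax f s d ≤ c := by
  induction d with
  | zero => exact h _ (by omega) (by omega)
  | succ d ih =>
    exact max_le (ih fun r h₁ h₂ => h r h₁ (by omega)) (h _ (by omega) (by omega))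

namespace Scalar

variable (D : Scalar)

/-- The nodes are `0` (the start), `3 * t + b` for `t = 1, …, T + 1` and `b < 3`, and the end. -/
def endNode : ℕ := 3 * (D.T + 2)

/-- The time of a node. -/
def tm (n : ℕ) : ℕ := min (n / 3) (D.T + 1)

/-- The value that a trajectory takes at a node when `q ≠ 0`: the lower or the upper bound or
zero. -/
noncomputable def nodeVal (n : ℕ) : ℝ :=
  if n % 3 = 0 then D.lo (D.tm n) else if n % 3 = 1 then D.hi (D.tm n) else 0

/-- The number of entries between two nodes that are charged as nonzero. -/
def weight (m n : ℕ) : ℕ := D.tm n - D.tm m - (if n % 3 = 2 then 1 else 0)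

/-- A value for a constant piece between two nodes. -/
noncomputable def blockVal (m n : ℕ) : ℝ :=
  if n % 3 = 2 then 0 else runMax D.lo (D.tm m) (D.tm n - (D.tm m + 1))

/-- The end node prescribes no value. The first case matters for a trajectory that touches nothing:
its only edge leads from the source to the end and needs a constant, for which the maximum of the
lower bounds is as good as any. -/
noncomputable def tgtVal (m n : ℕ) : ℝ :=
  if D.endNode ≤ n then D.blockVal m n else D.nodeVal n

/-- The source prescribes no value either: a piece that leaves it starts with its final value and is
constant. -/
noncomputable def startVal (m n : ℕ) : ℝ :=
  if D.tm m = 0 then D.tgtVal m n else D.nodeVal m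

/-- The last value of the piece between two nodes. -/
noncomputable def edgeVal (m n : ℕ) : ℝ :=
  if D.q = 0 then D.blockVal m n else if D.endNode ≤ n then D.startVal m n else D.tgtVal m n

/-- The slope of the piece between two nodes. -/
noncomputable def edgeSlope (m n : ℕ) : ℝ :=
  if D.q = 0 then 0 else (D.edgeVal m n - D.startVal m n) / (D.tm n - D.tm m : ℕ)

/-- The temporal cost charged for the piece between two nodes. -/
noncomputable def edgeCost (m n : ℕ) : ℝ :=
  if D.q = 0 then
    -- No jump is paid before the first block, into an empty block at the end, or between two
    -- adjacent zero blocks.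
    if D.tm m = 0 ∨ D.tm n ≤ D.tm m ∨ (m % 3 = 2 ∧ n % 3 = 2) then 0 else 1
  else (D.tm n - D.tm m : ℕ) * penalty D.q (D.edgeSlope m n)

/-- The piece between two nodes. -/
noncomputable def seg (m n r : ℕ) : ℝ := D.edgeVal m n - D.edgeSlope m n * (D.tm n - r : ℕ)

/-- The piece between two nodes stays within the bounds. -/
def EdgeOk (m n : ℕ) : Prop :=
  ∀ r, D.tm m < r → r ≤ D.tm n → D.lo r ≤ D.seg m n r ∧ D.seg m n r ≤ D.hi r

/-- The number of nonzero entries up to time `t`. -/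
noncomputable def cnt (x : ℕ → ℝ) (t : ℕ) : ℕ := ((Finset.Ioc 0 t).filter (fun r => x r ≠ 0)).card

/-- The temporal cost up to time `t`. -/
noncomputable def tcost (x : ℕ → ℝ) (t : ℕ) : ℝ :=
  ∑ r ∈ Finset.Ico 1 t, penalty D.q (x (r + 1) - x r)

/-- Feasibility of a trajectory. -/
def Feas (x : ℕ → ℝ) : Prop := ∀ r, 1 ≤ r → r ≤ D.T + 1 → D.lo r ≤ x r ∧ x r ≤ D.hi r

/-- The edge from `m` to `n` extends a path with budget `k - weight` to one with budget `k`. -/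
def Cand (fl : ℕ → ℕ → Prop) (n k m : ℕ) : Prop :=
  D.EdgeOk m n ∧ D.weight m n ≤ k ∧ fl m (k - D.weight m n)

/-- The optimality equation at node `n` with budget `k`: `fl` tells whether there is a path,
`V` is its cost and `X` its trajectory. -/
structure Cell (fl : ℕ → ℕ → Prop) (V : ℕ → ℕ → ℝ) (X : ℕ → ℕ → ℕ → ℝ) (n k : ℕ) : Prop where
  attained : fl n k → ∃ m, m < n - n % 3 ∧ D.Cand fl n k m ∧
    V n k = V m (k - D.weight m n) + D.edgeCost m n ∧
    ∀ r, 1 ≤ r → r ≤ D.tm n →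
      X n k r = if r ≤ D.tm m then X m (k - D.weight m n) r else D.seg m n r
  bound : ∀ m, m < n - n % 3 → D.Cand fl n k m →
    fl n k ∧ V n k ≤ V m (k - D.weight m n) + D.edgeCost m n

/-- A complete table of shortest paths. -/
structure Table (fl : ℕ → ℕ → Prop) (V : ℕ → ℕ → ℝ) (X : ℕ → ℕ → ℕ → ℝ) : Prop where
  source : ∀ k ≤ D.T + 1, fl 0 k ∧ V 0 k = 0
  -- The nodes 1 and 2 also have time zero; a path may start only at node 0.
  dead : ∀ k ≤ D.T + 1, ¬ fl 1 k ∧ ¬ fl 2 k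
  cell : ∀ n, 3 ≤ n → n ≤ D.endNode → ∀ k ≤ D.T + 1, D.Cell fl V X n k

/-! ### Counts, costs and pieces. -/

variable {D}

theorem cnt_congr {x y : ℕ → ℝ} {t : ℕ} (h : ∀ r, 1 ≤ r → r ≤ t → x r = y r) :
    cnt x t = cnt y t := by
  unfold cnt
  congr 1
  apply Finset.filter_congr
  intro r hr
  rw [Finset.mem_Ioc] at hr
  rw [h r hr.1 hr.2]

theorem cnt_split (x : ℕ → ℝ) {s t : ℕ} (h : s ≤ t) :
    cnt x t = cnt x s + ((Finset.Ioc s t).filter (fun r => x r ≠ 0)).card := by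
  unfold cnt
  rw [← Finset.card_union_of_disjoint, ← Finset.filter_union,
    Finset.Ioc_union_Ioc_eq_Ioc (Nat.zero_le _) h]
  rw [Finset.disjoint_left]
  intro a ha hb
  simp only [Finset.mem_filter, Finset.mem_Ioc] at ha hb
  omega

theorem tcost_congr {x y : ℕ → ℝ} {t : ℕ} (h : ∀ r, 1 ≤ r → r ≤ t → x r = y r) :
    D.tcost x t = D.tcost y t := by
  unfold tcost
  apply Finset.sum_congr rfl
  intro r hr
  rw [Finset.mem_Ico] at hr
  rw [h r (by omega) (by omega), h (r + 1) (by omega) (by omega)]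

theorem tcost_split (x : ℕ → ℝ) {s t : ℕ} (hs : 1 ≤ s) (h : s ≤ t) :
    D.tcost x t = D.tcost x s + ∑ r ∈ Finset.Ico s t, penalty D.q (x (r + 1) - x r) := by
  unfold tcost
  exact (Finset.sum_Ico_consecutive _ hs h).symm

theorem tcost_nonneg (x : ℕ → ℝ) (t : ℕ) : 0 ≤ D.tcost x t :=
  Finset.sum_nonneg fun _ _ => penalty_nonneg _ _

theorem seg_step {m n r : ℕ} (h : r < D.tm n) :
    D.seg m n (r + 1) - D.seg m n r = D.edgeSlope m n := by
  have : ((D.tm n - r : ℕ) : ℝ) = (D.tm n - (r + 1) : ℕ) + 1 := by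
    rw [show D.tm n - r = D.tm n - (r + 1) + 1 by omega]; push_cast; ring
  simp only [seg, this]; ring

theorem seg_last (m n : ℕ) : D.seg m n (D.tm n) = D.edgeVal m n := by simp [seg]

theorem edgeSlope_mul {m n : ℕ} (hq : D.q ≠ 0) (h : D.tm m < D.tm n) :
    D.edgeSlope m n * (D.tm n - D.tm m : ℕ) = D.edgeVal m n - D.startVal m n := by
  have : ((D.tm n - D.tm m : ℕ) : ℝ) ≠ 0 := by
    rw [Nat.cast_ne_zero]; omega
  rw [edgeSlope, if_neg hq]
  field_simp

/-- At time zero the start value is the target value, so the piece has slope zero. -/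
theorem penalty_slope_source (hq : D.q = 0 ∨ 1 ≤ D.q) {m n : ℕ} (hm : D.tm m = 0) :
    penalty D.q (D.edgeSlope m n) = 0 := by
  have : D.edgeSlope m n = 0 := by
    unfold edgeSlope edgeVal startVal
    split_ifs <;> simp
  rw [this, penalty_zero hq]

theorem edgeVal_eq_nodeVal {m n : ℕ} (hq : D.q ≠ 0) (hn : n < D.endNode) :
    D.edgeVal m n = D.nodeVal n := by
  rw [edgeVal, if_neg hq, if_neg (by omega), tgtVal, if_neg (by omega)]

theorem edgeVal_eq_zero {m n : ℕ} (hn : n < D.endNode) (h : n % 3 = 2) : D.edgeVal m n = 0 := by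
  by_cases hq : D.q = 0
  · rw [edgeVal, if_pos hq, blockVal, if_pos h]
  · rw [edgeVal_eq_nodeVal hq hn, nodeVal, if_neg (by omega), if_neg (by omega)]

theorem tm_le_of_lt {m n : ℕ} (h : m < n - n % 3) : D.tm m ≤ D.tm n := by
  unfold tm; omega

theorem tm_lt_of_lt {m n : ℕ} (h : m < n - n % 3) (hn : n < D.endNode) : D.tm m < D.tm n := by
  unfold tm; unfold endNode at hn; omega

/-! ### Soundness of the table. -/

section sound

variable {fl : ℕ → ℕ → Prop} {V : ℕ → ℕ → ℝ} {X : ℕ → ℕ → ℕ → ℝ}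

/-- The trajectories in a table are feasible, have at most `k` nonzero entries and cost at most
the value in the table. -/
theorem Table.sound_aux (hq : D.q = 0 ∨ 1 ≤ D.q) (H : D.Table fl V X) (n : ℕ)
    (hn : n ≤ D.endNode) (k : ℕ) (hk : k ≤ D.T + 1) (h : fl n k) :
    (∀ r, 1 ≤ r → r ≤ D.tm n → D.lo r ≤ X n k r ∧ X n k r ≤ D.hi r) ∧
    cnt (X n k) (D.tm n) ≤ k ∧ D.tcost (X n k) (D.tm n) ≤ V n k ∧
    (3 ≤ n → n < D.endNode → (D.q ≠ 0 → X n k (D.tm n) = D.nodeVal n) ∧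
      (n % 3 = 2 → X n k (D.tm n) = 0)) := by
  induction n using Nat.strong_induction_on generalizing k with
  | _ n ih =>
  rcases Nat.lt_or_ge n 3 with hn3 | hn3
  · have h0 : n = 0 := by
      have := H.dead k hk
      interval_cases n <;> tauto
    subst h0
    have : D.tm 0 = 0 := by simp [tm]
    refine ⟨fun r h₁ h₂ => by omega, by simp [this, cnt], ?_, by omega⟩
    simp [this, tcost, (H.source k hk).2]
  obtain ⟨m, hm, ⟨hok, hw, hfl⟩, hV, hX⟩ := (H.cell n hn3 hn k hk).attained h
  obtain ⟨a₁, a₂, a₃, a₄⟩ := ih m (by omega) (by omega) _ (by omega) hfl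
  have hst := tm_le_of_lt (D := D) hm
  have hX₁ : ∀ r, 1 ≤ r → r ≤ D.tm m → X n k r = X m (k - D.weight m n) r := fun r h₁ h₂ => by
    rw [hX r h₁ (by omega), if_pos h₂]
  have hX₂ : ∀ r, D.tm m < r → r ≤ D.tm n → X n k r = D.seg m n r := fun r h₁ h₂ => by
    rw [hX r (by omega) h₂, if_neg (by omega)]
  refine ⟨fun r h₁ h₂ => ?_, ?_, ?_, fun _ hnE => ?_⟩
  · rcases Nat.lt_or_ge (D.tm m) r with h₃ | h₃
    · rw [hX₂ r h₃ h₂]; exact hok r h₃ h₂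
    · rw [hX₁ r h₁ h₃]; exact a₁ r h₁ h₃
  · rw [cnt_split _ hst, cnt_congr hX₁]
    have : ((Finset.Ioc (D.tm m) (D.tm n)).filter (fun r => X n k r ≠ 0)).card ≤
        D.weight m n := by
      unfold weight
      split_ifs with h2
      · have hnE : n < D.endNode := by unfold endNode at *; omega
        have hlt := tm_lt_of_lt hm hnE
        -- The piece ends with a zero, so its nonzero entries lie strictly between the two times,
        -- and these number exactly the weight.
        rw [← Nat.card_Ioo]
        apply Finset.card_le_card
        intro r
        simp only [Finset.mem_filter, Finset.mem_Ioc, Finset.mem_Ioo]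
        rintro ⟨⟨h₁, h₃⟩, h₄⟩
        refine ⟨h₁, lt_of_le_of_ne h₃ ?_⟩
        rintro rfl
        exact h₄ (by rw [hX₂ _ h₁ h₃, seg_last, edgeVal_eq_zero hnE h2])
      · simpa using Finset.card_filter_le (Finset.Ioc (D.tm m) (D.tm n)) (fun r => X n k r ≠ 0)
    omega
  · have inner : ∀ r, D.tm m < r → r < D.tm n →
        penalty D.q (X n k (r + 1) - X n k r) = penalty D.q (D.edgeSlope m n) := fun r h₁ h₂ => by
      rw [hX₂ r h₁ h₂.le, hX₂ (r + 1) (by omega) h₂, seg_step h₂]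
    rw [hV]
    -- After the source the trajectory is one constant piece and costs nothing. Otherwise the
    -- increments of the new piece are added to the cost of the old trajectory.
    rcases Nat.eq_zero_or_pos (D.tm m) with hs | hs
    · have : D.tcost (X n k) (D.tm n) = 0 := by
        apply Finset.sum_eq_zero
        intro r hr
        rw [Finset.mem_Ico] at hr
        rw [inner r (by omega) hr.2, penalty_slope_source hq hs]
      rw [this]
      have : 0 ≤ D.edgeCost m n := by
        unfold edgeCost
        have := penalty_nonneg D.q (D.edgeSlope m n)
        split_ifs <;> positivity
      linarith [tcost_nonneg (D := D) (X m (k - D.weight m n)) (D.tm m)]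
    · rw [tcost_split _ hs hst, tcost_congr hX₁]
      refine add_le_add a₃ ?_
      rcases hst.eq_or_lt with he | hlt
      · rw [he, Finset.Ico_self, Finset.sum_empty, edgeCost]
        simp [he]
      have hm3 : 3 ≤ m := by
        by_contra hc
        simp only [tm] at hs
        omega
      have hmE : m < D.endNode := by omega
      obtain ⟨b₁, b₂⟩ := a₄ hm3 hmE
      -- The first increment joins the old trajectory to the new piece; only the later ones lie
      -- inside the piece.
      rw [Finset.sum_eq_sum_Ico_succ_bot hlt,
        Finset.sum_congr rfl (fun r hr => inner r (Finset.mem_Ico.1 hr).1 (Finset.mem_Ico.1 hr).2),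
        hX₁ _ hs le_rfl, hX₂ _ (Nat.lt_succ_self _) hlt]
      simp only [Finset.sum_const, Nat.card_Ico, nsmul_eq_mul]
      by_cases hq0 : D.q = 0
      · have hB : D.edgeSlope m n = 0 := by rw [edgeSlope, if_pos hq0]
        rw [hB, penalty_zero hq, mul_zero, add_zero, edgeCost, if_pos hq0]
        have h2 : ¬ D.tm n ≤ D.tm m := by omega
        by_cases hz : m % 3 = 2 ∧ n % 3 = 2
        · rw [if_pos (by tauto), b₂ hz.1, seg, hB, edgeVal, if_pos hq0, blockVal, if_pos hz.2]
          simp [penalty_zero hq]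
        · rw [if_neg (by rintro (h | h | h) <;> [omega; omega; exact hz h]), hq0]
          exact penalty_zero_le_one _
      -- For `q ≠ 0` the old trajectory ends at the value of node `m`, which is where the line of
      -- the new piece starts.
      · have hfirst : D.seg m n (D.tm m + 1) - X m (k - D.weight m n) (D.tm m) =
            D.edgeSlope m n := by
          have h₁ := edgeSlope_mul hq0 hlt
          have h₂ : ((D.tm n - D.tm m : ℕ) : ℝ) = (D.tm n - (D.tm m + 1) : ℕ) + 1 := by
            rw [show D.tm n - D.tm m = D.tm n - (D.tm m + 1) + 1 by omega]; push_cast; ring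
          rw [b₁ hq0, seg]
          rw [startVal, if_neg (by omega), h₂] at h₁
          linarith
        rw [hfirst, edgeCost, if_neg hq0]
        rw [show D.tm n - D.tm m = D.tm n - (D.tm m + 1) + 1 by omega]
        push_cast
        apply le_of_eq
        ring
  · rw [hX₂ _ (tm_lt_of_lt hm hnE) le_rfl, seg_last]
    exact ⟨fun h => edgeVal_eq_nodeVal h hnE, fun h => edgeVal_eq_zero hnE h⟩

/-- The end shares the time `T + 1` with the last proper nodes, so an edge from one of these to the
end is an empty piece. -/
theorem tm_endNode : D.tm D.endNode = D.T + 1 := by simp [tm, endNode]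

theorem Table.sound (hq : D.q = 0 ∨ 1 ≤ D.q) (H : D.Table fl V X) {k : ℕ} (hk : k ≤ D.T + 1)
    (h : fl D.endNode k) :
    D.Feas (X D.endNode k) ∧ cnt (X D.endNode k) (D.T + 1) ≤ k ∧
      D.tcost (X D.endNode k) (D.T + 1) ≤ V D.endNode k := by
  obtain ⟨h₁, h₂, h₃, -⟩ := H.sound_aux hq _ le_rfl k hk h
  rw [tm_endNode] at *
  exact ⟨h₁, h₂, h₃⟩

end sound

end Scalar

end ProxGL

namespace ProxGL

open RealRAM (penalty penalty_zero penalty_nonneg penalty_zero_le_one)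

namespace Scalar

variable {D : Scalar} {fl : ℕ → ℕ → Prop} {V : ℕ → ℕ → ℝ} {X : ℕ → ℕ → ℕ → ℝ}

/-! ### Trajectories as paths -/

/-- The edge from `m` to `n` is admissible and charges at most what `x` pays between the times
of the two nodes. -/
structure Link (D : Scalar) (x : ℕ → ℝ) (m n : ℕ) : Prop where
  ok : D.EdgeOk m n
  cost : D.tcost x (D.tm m) + D.edgeCost m n ≤ D.tcost x (D.tm n)
  weight : D.weight m n + cnt x (D.tm m) ≤ cnt x (D.tm n)

/-- Supplies the predecessor on a path through the times in `S`; the time 0 stands for the source.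
-/
theorem exists_last (S : ℕ → Prop) (t : ℕ) (ht : 0 < t) :
    ∃ s < t, (s = 0 ∨ S s) ∧ ∀ r, s < r → r < t → ¬ S r := by
  classical
  induction t with
  | zero => omega
  | succ t ih =>
    by_cases h : t = 0 ∨ S t
    · exact ⟨t, by omega, h, fun r h₁ h₂ => by omega⟩
    · obtain ⟨s, h₁, h₂, h₃⟩ := ih (by omega)
      refine ⟨s, by omega, h₂, fun r h₄ h₅ => ?_⟩
      rcases Nat.lt_or_ge r t with h₆ | h₆
      · exact h₃ r h₄ h₆
      · rw [show r = t by omega]; tauto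

/-- One relaxation step. The budget left for `m` is still at least the number of nonzero entries of
`x` up to the time of `m`, because the link does not overcharge. -/
theorem Link.relax {x : ℕ → ℝ} {m n k : ℕ} (hn3 : 3 ≤ n) (hnE : n ≤ D.endNode)
    (H : D.Table fl V X) (h : D.Link x m n)
    (hm : m < n - n % 3)
    (ih : ∀ k ≤ D.T + 1, cnt x (D.tm m) ≤ k → fl m k ∧ V m k ≤ D.tcost x (D.tm m))
    (hk : k ≤ D.T + 1) (hc : cnt x (D.tm n) ≤ k) :
    fl n k ∧ V n k ≤ D.tcost x (D.tm n) := by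
  have hw := h.weight
  obtain ⟨h₁, h₂⟩ := ih (k - D.weight m n) (by omega) (by omega)
  obtain ⟨h₃, h₄⟩ := (H.cell n hn3 hnE k hk).bound m hm ⟨h.ok, by omega, h₁⟩
  exact ⟨h₃, by linarith [h.cost]⟩

/-- A trajectory is followed from each time in `S` to the next, and the relaxations are chained by
strong induction on the time. -/
theorem Table.complete_of_links (H : D.Table fl V X) {x : ℕ → ℝ} (S : ℕ → Prop) (nd : ℕ → ℕ)
    (nd0 : nd 0 = 0) (hnd : ∀ t, nd t / 3 = t)
    (step : ∀ s t, s < t → t ≤ D.T + 1 → (s = 0 ∨ S s) → S t → (∀ r, s < r → r < t → ¬ S r) →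
      D.Link x (nd s) (nd t))
    (fin : ∀ s ≤ D.T + 1, (s = 0 ∨ S s) → (∀ r, s < r → r ≤ D.T + 1 → ¬ S r) →
      D.Link x (nd s) D.endNode) {k : ℕ} (hk : k ≤ D.T + 1) (hc : cnt x (D.T + 1) ≤ k) :
    fl D.endNode k ∧ V D.endNode k ≤ D.tcost x (D.T + 1) := by
  have htm : ∀ t ≤ D.T + 1, D.tm (nd t) = t := fun t ht => by
    rw [tm, hnd]; omega
  have main : ∀ t ≤ D.T + 1, (t = 0 ∨ S t) → ∀ k ≤ D.T + 1, cnt x t ≤ k →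
      fl (nd t) k ∧ V (nd t) k ≤ D.tcost x t := by
    intro t
    induction t using Nat.strong_induction_on with
    | _ t ih =>
    intro ht hS k hk hc
    rcases Nat.eq_zero_or_pos t with rfl | h0
    · rw [nd0]
      obtain ⟨h₁, h₂⟩ := H.source k hk
      exact ⟨h₁, by simp [h₂, tcost]⟩
    obtain ⟨s, hst, hs, hbet⟩ := exists_last S t h0
    have h := step s t hst ht hs (hS.resolve_left (by omega)) hbet
    have ht' := hnd t
    have hs' := hnd s
    have e := htm t ht
    suffices fl (nd t) k ∧ V (nd t) k ≤ D.tcost x (D.tm (nd t)) by rwa [e] at this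
    rw [← e] at hc
    refine h.relax (by omega) (by unfold endNode; omega) H (by omega) (fun k hk hc => ?_) hk hc
    rw [htm s (by omega)] at hc ⊢
    exact ih s hst (by omega) hs k hk hc
  -- The last time in `S` up to `T + 1`, from which the path goes to the end.
  obtain ⟨s, hst, hs, hbet⟩ := exists_last S (D.T + 2) (by omega)
  have h := fin s (by omega) hs (fun r h₁ h₂ => hbet r h₁ (by omega))
  have hs' := hnd s
  rw [← tm_endNode] at hc ⊢
  refine h.relax (by unfold endNode; omega) le_rfl H (by unfold endNode; omega)
    (fun k hk hc => ?_) hk hc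
  rw [htm s (by omega)] at hc ⊢
  exact main s (by omega) hs k hk hc

theorem card_filter_nonzero {x : ℕ → ℝ} {s t : ℕ} (h : ∀ r, s < r → r ≤ t → x r ≠ 0) :
    ((Finset.Ioc s t).filter (fun r => x r ≠ 0)).card = t - s := by
  rw [Finset.filter_true_of_mem, Nat.card_Ioc]
  intro r hr
  rw [Finset.mem_Ioc] at hr
  exact h r hr.1 hr.2

/-- If `x` has no zero strictly inside the piece, all entries that the edge charges are nonzero in
`x`. The alternative in `hn` is the empty piece at the end. -/
theorem weight_add_cnt_le {x : ℕ → ℝ} {m n : ℕ} (hmn : D.tm m ≤ D.tm n)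
    (h : ∀ r, D.tm m < r → r < D.tm n → x r ≠ 0)
    (hn : n % 3 ≠ 2 → x (D.tm n) ≠ 0 ∨ D.tm n ≤ D.tm m) :
    D.weight m n + cnt x (D.tm m) ≤ cnt x (D.tm n) := by
  rw [cnt_split x hmn]
  have key : D.weight m n ≤
      ((Finset.Ioc (D.tm m) (D.tm n)).filter (fun r => x r ≠ 0)).card := by
    unfold weight
    split_ifs with h2
    · rcases hmn.eq_or_lt with h3 | h3
      · omega
      have : (Finset.Ioc (D.tm m) (D.tm n - 1)).filter (fun r => x r ≠ 0) ⊆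
          (Finset.Ioc (D.tm m) (D.tm n)).filter (fun r => x r ≠ 0) :=
        Finset.filter_subset_filter _ (Finset.Ioc_subset_Ioc_right (by omega))
      have := Finset.card_le_card this
      rw [card_filter_nonzero (fun r h₁ h₂ => h r h₁ (by omega))] at this
      omega
    · rcases hn h2 with h3 | h3
      · rw [card_filter_nonzero]
        · omega
        intro r h₁ h₂
        rcases h₂.eq_or_lt with rfl | h₂
        · exact h3
        · exact h r h₁ h₂
      · omega
  omega

/-- Completeness for the penalty that counts changes. -/
theorem Table.complete_zero (hq : D.q = 0) (H : D.Table fl V X) {x : ℕ → ℝ} (hx : D.Feas x)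
    {k : ℕ} (hk : k ≤ D.T + 1) (hc : cnt x (D.T + 1) ≤ k) :
    fl D.endNode k ∧ V D.endNode k ≤ D.tcost x (D.T + 1) := by
  classical
  -- The last times of the maximal constant runs, together with every zero, so that zero runs become
  -- single entries, and `T + 1`, so that the last edge is empty.
  set S : ℕ → Prop := fun t => x t = 0 ∨ t = D.T + 1 ∨ x (t + 1) ≠ x t with hS
  -- Only the distinction between zero and nonzero matters for `q = 0`; type 1 is not needed.
  set nd : ℕ → ℕ := fun t => if t = 0 ∨ x t ≠ 0 then 3 * t else 3 * t + 2 with hnd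
  have hnd' : ∀ t, nd t / 3 = t := fun t => by
    simp only [hnd]; split_ifs <;> omega
  have htm : ∀ t ≤ D.T + 1, D.tm (nd t) = t := fun t ht => by
    rw [tm, hnd']; omega
  have hB : ∀ m n, D.edgeSlope m n = 0 := fun m n => by rw [edgeSlope, if_pos hq]
  refine H.complete_of_links S nd (by simp [hnd]) hnd' ?_ ?_ hk hc
  · intro s t hst ht hs hSt hbet
    have hconst : ∀ d, s < t - d → x (t - d) = x t := by
      intro d
      induction d with
      | zero => simp
      | succ d ih =>
        intro hd
        have h₁ := hbet (t - (d + 1)) hd (by omega)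
        simp only [hS, not_or, not_not] at h₁
        rw [← ih (by omega), ← h₁.2.2]
        congr 1; omega
    have hconst' : ∀ r, s < r → r ≤ t → x r = x t := fun r h₁ h₂ => by
      have := hconst (t - r) (by omega)
      rwa [show t - (t - r) = r by omega] at this
    have hne : ∀ r, s < r → r < t → x r ≠ 0 := fun r h₁ h₂ h => hbet r h₁ h₂ (Or.inl h)
    have hndt : nd t % 3 = 2 ↔ x t = 0 := by
      simp only [hnd]; split_ifs with h
      · rcases h with h | h
        · omega
        · simp [h]
      · push Not at h
        simp only [h.2, iff_true]; omega
    have hts := htm s (by omega)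
    have htt := htm t ht
    refine ⟨?_, ?_, ?_⟩
    · intro r h₁ h₂
      rw [hts] at h₁
      rw [htt] at h₂
      rw [seg, hB, zero_mul, sub_zero, edgeVal, if_pos hq, blockVal]
      split_ifs with h3
      · rw [hndt] at h3
        rw [← h3, ← hconst' r h₁ h₂]
        exact hx r (by omega) (by omega)
      · rw [hts, htt]
        refine ⟨le_runMax _ _ _ _ h₁ (by omega), runMax_le _ _ _ _ fun r' h₃ h₄ => ?_⟩
        calc D.lo r' ≤ x r' := (hx r' (by omega) (by omega)).1
          _ = x r := by rw [hconst' r' h₃ (by omega), hconst' r h₁ h₂]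
          _ ≤ _ := (hx r (by omega) (by omega)).2
    · rw [hts, htt, edgeCost, if_pos hq, hts, htt]
      rcases Nat.eq_zero_or_pos s with rfl | hs0
      · simpa [tcost] using tcost_nonneg (D := D) x t
      rw [tcost_split x hs0 hst.le, Finset.sum_eq_sum_Ico_succ_bot hst]
      have hrest : 0 ≤ ∑ r ∈ Finset.Ico (s + 1) t, penalty D.q (x (r + 1) - x r) :=
        Finset.sum_nonneg fun _ _ => penalty_nonneg _ _
      have hp := penalty_nonneg D.q (x (s + 1) - x s)
      split_ifs with h3
      · linarith
      -- The edge is charged, so `x` must jump at `s`: if `s` belongs to `S` as a zero and `x` did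
      -- not jump, the next block would be zero as well, and the edge free.
      · have h4 : x (s + 1) - x s ≠ 0 := by
          rw [sub_ne_zero]
          rcases hs with h | h | h | h
          · omega
          · intro h5
            apply h3
            right; right
            refine ⟨?_, hndt.2 ?_⟩
            · have : ¬ (s = 0 ∨ x s ≠ 0) := by rw [not_or]; exact ⟨by omega, not_not.2 h⟩
              simp only [hnd, if_neg this]; omega
            · rw [← hconst' (s + 1) (by omega) hst, h5, h]
          · omega
          · exact h
        have h5 : penalty D.q (x (s + 1) - x s) = 1 := by simp [penalty, hq, h4]
        linarith
    · refine weight_add_cnt_le (by omega) ?_ ?_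
      · rw [hts, htt]; exact hne
      · rw [Ne, hndt, htt]; exact Or.inl
  · intro s hs _ hbet
    have : s = D.T + 1 := by
      by_contra h
      exact hbet (D.T + 1) (by omega) le_rfl (Or.inr (Or.inl rfl))
    subst this
    have h₁ := htm (D.T + 1) le_rfl
    refine ⟨fun r h₂ h₃ => ?_, ?_, ?_⟩
    · rw [tm_endNode] at h₃; omega
    · rw [h₁, tm_endNode, edgeCost, if_pos hq, tm_endNode, h₁]
      simp
    · rw [weight, h₁, tm_endNode]
      omega

/-! ### Removing kinks -/

theorem convexOn_penalty {q : ℝ} (hq : 1 ≤ q) : ConvexOn ℝ Set.univ (penalty q) := by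
  have hq0 : q ≠ 0 := by linarith
  refine ⟨convex_univ, fun x _ y _ a b ha hb hab => ?_⟩
  simp only [penalty, if_neg hq0, smul_eq_mul]
  calc |a * x + b * y| ^ q ≤ (a * |x| + b * |y|) ^ q := by
        refine Real.rpow_le_rpow (abs_nonneg _) ?_ (by linarith)
        refine (abs_add_le _ _).trans ?_
        rw [abs_mul, abs_mul, abs_of_nonneg ha, abs_of_nonneg hb]
    _ ≤ _ := (convexOn_rpow hq).2 (abs_nonneg x) (abs_nonneg y) ha hb hab

theorem continuous_penalty {q : ℝ} (hq : 1 ≤ q) : Continuous (penalty q) := by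
  have hq0 : q ≠ 0 := by linarith
  have : penalty q = fun x => |x| ^ q := by
    funext x; simp [penalty, hq0]
  rw [this]
  exact continuous_abs.rpow_const fun _ => Or.inr (by linarith)

/-- Changing the value at `t` affects only the increments next to `t`; the rest is collected in `R`,
so that costs before and after the change are compared by at most two terms. -/
theorem sum_update_diff (φ : ℝ → ℝ) (T : ℕ) (y : ℕ → ℝ) {t : ℕ} (ht : 1 ≤ t) (htT : t ≤ T + 1) :
    ∃ R, ∀ v, ∑ r ∈ Finset.Ico 1 (T + 1),
        φ (Function.update y t v (r + 1) - Function.update y t v r) =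
      R + (if 1 < t then φ (v - y (t - 1)) else 0) + (if t ≤ T then φ (y (t + 1) - v) else 0) := by
  refine ⟨∑ r ∈ Finset.Ico 1 (T + 1), if r = t - 1 ∨ r = t then 0 else φ (y (r + 1) - y r),
    fun v => ?_⟩
  have : ∀ r ∈ Finset.Ico 1 (T + 1),
      φ (Function.update y t v (r + 1) - Function.update y t v r) =
      (if r = t - 1 ∨ r = t then 0 else φ (y (r + 1) - y r)) +
        (if r = t - 1 then φ (v - y (t - 1)) else 0) +
        (if r = t then φ (y (t + 1) - v) else 0) := by
    intro r hr
    rw [Finset.mem_Ico] at hr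
    simp only [Function.update_apply]
    by_cases h₁ : r = t
    · subst h₁
      rw [if_neg (by omega), if_pos rfl, if_pos (Or.inr rfl), if_neg (by omega), if_pos rfl]
      ring
    · by_cases h₂ : r = t - 1
      · subst h₂
        rw [if_pos (by omega), if_neg h₁, if_pos (Or.inl rfl), if_pos rfl, if_neg h₁]
        ring
      · rw [if_neg (by omega), if_neg h₁, if_neg (by tauto), if_neg h₂, if_neg h₁]
        ring
  rw [Finset.sum_congr rfl this, Finset.sum_add_distrib, Finset.sum_add_distrib,
    Finset.sum_ite_eq', Finset.sum_ite_eq']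
  congr 1
  · congr 1
    simp only [Finset.mem_Ico]
    split_ifs <;> first | rfl | omega
  · simp only [Finset.mem_Ico]
    split_ifs <;> first | rfl | omega

/-- The increments of a sequence, extended by zero outside the times `1, …, T`. -/
noncomputable def incr (T : ℕ) (y : ℕ → ℝ) (t : ℕ) : ℝ :=
  if 1 ≤ t ∧ t ≤ T then y (t + 1) - y t else 0

/-- A value near `y t` that does not increase the convex cost and decreases the quadratic one. -/
theorem exists_improvement (T : ℕ) (y : ℕ → ℝ) {t : ℕ} (ht : 1 ≤ t) (htT : t ≤ T + 1)
    (hd : incr T y t ≠ incr T y (t - 1)) : ∃ c : ℝ, ∀ l, 0 < l → l ≤ 1 → ∀ φ : ℝ → ℝ,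
      ConvexOn ℝ Set.univ φ → φ 0 = 0 → (∀ x, 0 ≤ φ x) →
      ((if 1 < t then φ (y t + l * (c - y t) - y (t - 1)) else 0) +
          (if t ≤ T then φ (y (t + 1) - (y t + l * (c - y t))) else 0) ≤
        (if 1 < t then φ (y t - y (t - 1)) else 0) +
          (if t ≤ T then φ (y (t + 1) - y t) else 0)) ∧
      ((if 1 < t then (y t + l * (c - y t) - y (t - 1)) ^ 2 else 0) +
          (if t ≤ T then (y (t + 1) - (y t + l * (c - y t))) ^ 2 else 0) <
        (if 1 < t then (y t - y (t - 1)) ^ 2 else 0) +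
          (if t ≤ T then (y (t + 1) - y t) ^ 2 else 0)) := by
  have shrink : ∀ l : ℝ, 0 < l → l ≤ 1 → ∀ φ : ℝ → ℝ, ConvexOn ℝ Set.univ φ → φ 0 = 0 →
      (∀ x, 0 ≤ φ x) → ∀ a, φ ((1 - l) * a) ≤ φ a := by
    intro l h₀ h₁ φ hφ hφ0 hpos a
    have := hφ.2 (Set.mem_univ a) (Set.mem_univ 0) (sub_nonneg.2 h₁) h₀.le (by ring)
    simp only [smul_eq_mul, mul_zero, add_zero, hφ0] at this
    nlinarith [hpos a]
  have shrinksq : ∀ l : ℝ, 0 < l → l ≤ 1 → ∀ a : ℝ, a ≠ 0 → ((1 - l) * a) ^ 2 < a ^ 2 := by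
    intro l h₀ h₁ a ha
    have : 0 < a ^ 2 := by positivity
    rw [mul_pow]
    have h₂ : (1 - l) ^ 2 < 1 := by nlinarith
    nlinarith
  unfold incr at hd
  by_cases h1 : 1 < t
  · by_cases h2 : t ≤ T
    · rw [if_pos ⟨ht, h2⟩, if_pos (by omega), show t - 1 + 1 = t by omega] at hd
      -- Towards the midpoint of the neighbours the two increments `a`, `b` become convex
      -- combinations with exchanged weights, so no convex sum grows, and the sum of squares drops
      -- since `a ≠ b`.
      refine ⟨(y (t - 1) + y (t + 1)) / 2, fun l h₀ h₁ φ hφ hφ0 hpos => ?_⟩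
      simp only [if_pos h1, if_pos h2]
      have e₁ : y t + l * ((y (t - 1) + y (t + 1)) / 2 - y t) - y (t - 1) =
          (1 - l / 2) * (y t - y (t - 1)) + (l / 2) * (y (t + 1) - y t) := by ring
      have e₂ : y (t + 1) - (y t + l * ((y (t - 1) + y (t + 1)) / 2 - y t)) =
          (l / 2) * (y t - y (t - 1)) + (1 - l / 2) * (y (t + 1) - y t) := by ring
      rw [e₁, e₂]
      generalize y t - y (t - 1) = a at *
      generalize y (t + 1) - y t = b at *
      have c₁ := hφ.2 (Set.mem_univ a) (Set.mem_univ b) (show 0 ≤ 1 - l / 2 by linarith)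
        (show 0 ≤ l / 2 by linarith) (by ring)
      have c₂ := hφ.2 (Set.mem_univ a) (Set.mem_univ b) (show 0 ≤ l / 2 by linarith)
        (show 0 ≤ 1 - l / 2 by linarith) (by ring)
      simp only [smul_eq_mul] at c₁ c₂
      refine ⟨by linarith, ?_⟩
      have hab : 0 < (b - a) ^ 2 := by
        have := sub_ne_zero.2 hd
        positivity
      have : 0 < l * (1 - l / 2) * (b - a) ^ 2 := by
        have : 0 < 1 - l / 2 := by linarith
        positivity
      nlinarith
    · rw [if_neg (by omega), if_pos (by omega), show t - 1 + 1 = t by omega] at hd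
      -- At the last time only one increment is involved, and it shrinks; the first time is
      -- symmetric.
      refine ⟨y (t - 1), fun l h₀ h₁ φ hφ hφ0 hpos => ?_⟩
      simp only [if_pos h1, if_neg h2, add_zero]
      rw [show y t + l * (y (t - 1) - y t) - y (t - 1) = (1 - l) * (y t - y (t - 1)) by ring]
      exact ⟨shrink l h₀ h₁ φ hφ hφ0 hpos _, shrinksq l h₀ h₁ _ (Ne.symm hd)⟩
  · by_cases h2 : t ≤ T
    · rw [if_pos ⟨ht, h2⟩, if_neg (by omega)] at hd
      refine ⟨y (t + 1), fun l h₀ h₁ φ hφ hφ0 hpos => ?_⟩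
      simp only [if_neg h1, if_pos h2, zero_add]
      rw [show y (t + 1) - (y t + l * (y (t + 1) - y t)) = (1 - l) * (y (t + 1) - y t) by ring]
      exact ⟨shrink l h₀ h₁ φ hφ hφ0 hpos _, shrinksq l h₀ h₁ _ hd⟩
    · exact absurd (by rw [if_neg (by omega), if_neg (by omega)]) hd

/-- The trajectory touches a bound or zero. -/
def Touch (D : Scalar) (y : ℕ → ℝ) (t : ℕ) : Prop := y t = 0 ∨ y t = D.lo t ∨ y t = D.hi t

/-- Among the feasible trajectories that keep the zeros of `x` and cost no more, take one with the
least sum of squared increments. At a time where it is free to move, a kink would permit a local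
improvement. The extension of `incr` by zero makes this include the first and the last time, where
the trajectory must be flat. -/
theorem exists_smooth (hq : 1 ≤ D.q) {x : ℕ → ℝ} (hx : D.Feas x) :
    ∃ y, D.Feas y ∧ D.tcost y (D.T + 1) ≤ D.tcost x (D.T + 1) ∧
      cnt y (D.T + 1) ≤ cnt x (D.T + 1) ∧
      ∀ t, 1 ≤ t → t ≤ D.T + 1 → ¬ D.Touch y t → incr D.T y t = incr D.T y (t - 1) := by
  classical
  -- Freezing the zeros of `x` keeps the count from growing; freezing the irrelevant times makes the
  -- product compact.
  set B : ℕ → Set ℝ := fun r =>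
    if 1 ≤ r ∧ r ≤ D.T + 1 ∧ x r ≠ 0 then Set.Icc (D.lo r) (D.hi r) else {x r} with hB
  set K : Set (ℕ → ℝ) := Set.pi Set.univ B ∩ {y | D.tcost y (D.T + 1) ≤ D.tcost x (D.T + 1)}
    with hK
  have hBc : ∀ r, IsCompact (B r) := fun r => by
    simp only [hB]; split_ifs
    · exact isCompact_Icc
    · exact isCompact_singleton
  have hcont : Continuous fun y : ℕ → ℝ => D.tcost y (D.T + 1) := by
    unfold tcost
    exact continuous_finsetSum _ fun r _ => (continuous_penalty hq).comp
      ((continuous_apply (r + 1)).sub (continuous_apply r))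
  have hKc : IsCompact K :=
    (isCompact_univ_pi hBc).inter_right (isClosed_le hcont continuous_const)
  have hxK : x ∈ K := by
    refine ⟨fun r _ => ?_, by rw [Set.mem_ofPred_eq]⟩
    simp only [hB]; split_ifs with h
    · exact hx r h.1 h.2.1
    · rfl
  -- The penalty is not strictly convex for `q = 1`, so its minimizers may have kinks; the strictly
  -- convex squares select one without.
  obtain ⟨y, ⟨hyB, hyc⟩, hymin⟩ := hKc.exists_isMinOn ⟨x, hxK⟩
    (f := fun y => ∑ r ∈ Finset.Ico 1 (D.T + 1), (y (r + 1) - y r) ^ 2)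
    (continuous_finsetSum _ fun r _ =>
      (((continuous_apply (r + 1)).sub (continuous_apply r)).pow 2)).continuousOn
  rw [Set.mem_ofPred_eq] at hyc
  have hy : ∀ r, 1 ≤ r → r ≤ D.T + 1 → (D.lo r ≤ y r ∧ y r ≤ D.hi r) ∧ (x r = 0 → y r = 0) := by
    intro r h₁ h₂
    have := hyB r (Set.mem_univ r)
    simp only [hB] at this
    split_ifs at this with h
    · exact ⟨this, fun h' => absurd h' h.2.2⟩
    · rw [Set.mem_singleton_iff] at this
      rw [this]
      exact ⟨hx r h₁ h₂, id⟩
  refine ⟨y, fun r h₁ h₂ => (hy r h₁ h₂).1, hyc, ?_, fun t ht htT hS => ?_⟩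
  · apply Finset.card_le_card
    intro r hr
    simp only [Finset.mem_filter, Finset.mem_Ioc] at hr ⊢
    exact ⟨hr.1, fun h => hr.2 ((hy r hr.1.1 hr.1.2).2 h)⟩
  by_contra hd
  obtain ⟨c, hc⟩ := exists_improvement D.T y ht htT hd
  simp only [Touch, not_or] at hS
  obtain ⟨⟨hlo, hhi⟩, hz⟩ := hy t ht htT
  have hlo' : D.lo t < y t := lt_of_le_of_ne hlo (Ne.symm hS.2.1)
  have hhi' : y t < D.hi t := lt_of_le_of_ne hhi hS.2.2
  -- The value lies strictly between its bounds, so a short move towards `c` is feasible.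
  obtain ⟨l, h₀, h₁, hl⟩ : ∃ l : ℝ, 0 < l ∧ l ≤ 1 ∧
      y t + l * (c - y t) ∈ Set.Ioo (D.lo t) (D.hi t) := by
    have hcl : Filter.Tendsto (fun l : ℝ => y t + l * (c - y t)) (nhdsWithin 0 (Set.Ioi 0))
        (nhds (y t)) := by
      have : Continuous (fun l : ℝ => y t + l * (c - y t)) := by fun_prop
      have h := (this.tendsto 0).mono_left (nhdsWithin_le_nhds (s := Set.Ioi 0))
      simpa using h
    have e₁ := hcl.eventually (Ioo_mem_nhds hlo' hhi')
    have e₂ : ∀ᶠ l : ℝ in nhdsWithin 0 (Set.Ioi 0), l ∈ Set.Ioc (0 : ℝ) 1 :=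
      Ioc_mem_nhdsGT one_pos
    obtain ⟨l, h₁, h₂⟩ := (e₁.and e₂).exists
    exact ⟨l, h₂.1, h₂.2, h₁⟩
  obtain ⟨hφ, hsq⟩ := hc l h₀ h₁ _ (convexOn_penalty hq) (penalty_zero (Or.inr hq))
    (penalty_nonneg _)
  obtain ⟨R₁, hR₁⟩ := sum_update_diff (penalty D.q) D.T y ht htT
  obtain ⟨R₂, hR₂⟩ := sum_update_diff (fun a => a ^ 2) D.T y ht htT
  have hmem : Function.update y t (y t + l * (c - y t)) ∈ K := by
    refine ⟨fun r _ => ?_, ?_⟩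
    · rw [Function.update_apply]
      split_ifs with hr
      · subst hr
        simp only [hB]
        rw [if_pos ⟨ht, htT, fun h => hS.1 (hz h)⟩]
        exact Set.Ioo_subset_Icc_self hl
      · exact hyB r (Set.mem_univ r)
    · rw [Set.mem_ofPred_eq]
      refine le_trans ?_ hyc
      have h₂ := hR₁ (y t)
      rw [Function.update_eq_self] at h₂
      unfold tcost
      rw [hR₁, h₂]
      linarith
  have h₃ := hymin hmem
  have h₂ := hR₂ (y t)
  rw [Function.update_eq_self] at h₂
  simp only [Set.mem_ofPred_eq] at h₃
  rw [hR₂, h₂] at h₃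
  linarith

end Scalar

end ProxGL

/-! ### Completeness of the table for `q ≥ 1` and in general. -/

namespace ProxGL

open RealRAM (penalty penalty_zero penalty_nonneg penalty_zero_le_one)

namespace Scalar

variable {D : Scalar} {fl : ℕ → ℕ → Prop} {V : ℕ → ℕ → ℝ} {X : ℕ → ℕ → ℕ → ℝ}

/-- Where `x` is affine with the slope of the edge, both costs are the same sum of equal terms; from
the source the edge is free. -/
theorem Link.of_line (hq : 1 ≤ D.q) {y : ℕ → ℝ} {m n : ℕ} (hmn : D.tm m ≤ D.tm n)
    (hok : D.EdgeOk m n)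
    (hline : ∀ r, 1 ≤ r → D.tm m ≤ r → r < D.tm n → y (r + 1) - y r = D.edgeSlope m n)
    (hne : ∀ r, D.tm m < r → r < D.tm n → y r ≠ 0)
    (hn : n % 3 ≠ 2 → y (D.tm n) ≠ 0 ∨ D.tm n ≤ D.tm m) : D.Link y m n := by
  refine ⟨hok, ?_, weight_add_cnt_le hmn hne hn⟩
  have hq0 : D.q ≠ 0 := by linarith
  rw [edgeCost, if_neg hq0]
  rcases Nat.eq_zero_or_pos (D.tm m) with hs | hs
  · rw [penalty_slope_source (Or.inr hq) hs, hs]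
    simpa [tcost] using tcost_nonneg (D := D) y (D.tm n)
  · have : ∀ r ∈ Finset.Ico (D.tm m) (D.tm n),
        penalty D.q (y (r + 1) - y r) = penalty D.q (D.edgeSlope m n) := fun r hr => by
      rw [Finset.mem_Ico] at hr
      rw [hline r (by omega) hr.1 hr.2]
    rw [tcost_split y hs hmn, Finset.sum_congr rfl this]
    simp

/-- The path visits the times at which `y` touches zero or a bound. In between the increments are
constant, so `y` is the line that the edge prescribes, and `y` has no zero there. -/
theorem Table.complete_of_smooth (hq : 1 ≤ D.q) (H : D.Table fl V X) {y : ℕ → ℝ} (hy : D.Feas y)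
    (hs : ∀ t, 1 ≤ t → t ≤ D.T + 1 → ¬ D.Touch y t → incr D.T y t = incr D.T y (t - 1))
    {k : ℕ} (hk : k ≤ D.T + 1) (hc : cnt y (D.T + 1) ≤ k) :
    fl D.endNode k ∧ V D.endNode k ≤ D.tcost y (D.T + 1) := by
  classical
  have hq0 : D.q ≠ 0 := by linarith
  -- Zero takes precedence over the bounds, so that nodes of the types 0 and 1 have nonzero values
  -- and are charged correctly.
  set nd : ℕ → ℕ := fun t => if t = 0 then 0 else if y t = 0 then 3 * t + 2 else
    if y t = D.lo t then 3 * t else 3 * t + 1 with hnd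
  have hnd' : ∀ t, nd t / 3 = t := fun t => by
    simp only [hnd]; split_ifs <;> omega
  have htm : ∀ t ≤ D.T + 1, D.tm (nd t) = t := fun t ht => by
    rw [tm, hnd']; omega
  have hval : ∀ t, 1 ≤ t → t ≤ D.T + 1 → D.Touch y t → D.nodeVal (nd t) = y t := by
    intro t h₁ h₂ h₃
    rw [nodeVal, htm t h₂]
    have h₀ : t ≠ 0 := by omega
    by_cases hz : y t = 0
    · have : nd t = 3 * t + 2 := by simp only [hnd, if_neg h₀, if_pos hz]
      rw [if_neg (by omega), if_neg (by omega), hz]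
    · by_cases hl : y t = D.lo t
      · have : nd t = 3 * t := by simp only [hnd, if_neg h₀, if_neg hz, if_pos hl]
        rw [if_pos (by omega), hl]
      · have : nd t = 3 * t + 1 := by simp only [hnd, if_neg h₀, if_neg hz, if_neg hl]
        rw [if_neg (by omega), if_pos (by omega)]
        rcases h₃ with h | h | h
        · exact absurd h hz
        · exact absurd h hl
        · exact h.symm
  have htype : ∀ t, 1 ≤ t → nd t % 3 ≠ 2 → y t ≠ 0 := by
    intro t h₁ h₂ hz
    have : nd t = 3 * t + 2 := by simp only [hnd, if_neg (show t ≠ 0 by omega), if_pos hz]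
    omega
  have hincr : ∀ s t, s < t → t ≤ D.T + 2 → (∀ r, s < r → r < t → ¬ D.Touch y r) →
      ∀ d, s + d < t → incr D.T y (s + d) = incr D.T y s := by
    intro s t _ ht hbet d
    induction d with
    | zero => intro _; rfl
    | succ d ih =>
      intro hd
      rw [hs _ (by omega) (by omega) (hbet _ (by omega) hd), ← ih (by omega)]
      rfl
  have hincr' : ∀ s t, s < t → t ≤ D.T + 2 → (∀ r, s < r → r < t → ¬ D.Touch y r) →
      ∀ r, s ≤ r → r < t → incr D.T y r = incr D.T y s := by
    intro s t h ht hbet r h₁ h₂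
    have := hincr s t h ht hbet (r - s) (by omega)
    rwa [show s + (r - s) = r by omega] at this
  have hlin : ∀ s t (β : ℝ), t ≤ D.T + 1 → (∀ r, 1 ≤ r → s ≤ r → r < t → y (r + 1) - y r = β) →
      ∀ d, s ≤ t - d → 1 ≤ t - d → d ≤ t → y (t - d) = y t - β * d := by
    intro s t β ht h d
    induction d with
    | zero => intros; simp
    | succ d ih =>
      intro h₁ h₂ h₃
      have h₄ := ih (by omega) (by omega) (by omega)
      have h₅ := h (t - (d + 1)) h₂ h₁ (by omega)
      rw [show t - (d + 1) + 1 = t - d by omega, h₄] at h₅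
      push_cast
      linarith
  refine H.complete_of_links (D.Touch y) nd (by simp [hnd]) hnd' ?_ ?_ hk hc
  · intro s t hst ht hsS hSt hbet
    have hts := htm s (by omega)
    have htt := htm t ht
    have hnE : nd t < D.endNode := by have := hnd' t; unfold endNode; omega
    have hev : D.edgeVal (nd s) (nd t) = y t := by
      rw [edgeVal_eq_nodeVal hq0 hnE, hval t (by omega) ht hSt]
    have hstep : ∀ r, 1 ≤ r → s ≤ r → r < t → y (r + 1) - y r = incr D.T y s := by
      intro r h₁ h₂ h₃
      rw [← hincr' s t hst (by omega) hbet r h₂ h₃, incr, if_pos (by omega)]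
    have hlin' := hlin s t _ ht hstep
    have hslope : D.edgeSlope (nd s) (nd t) = incr D.T y s := by
      rcases Nat.eq_zero_or_pos s with rfl | hs0
      · rw [edgeSlope, if_neg hq0, hev, startVal, if_pos hts, tgtVal, if_neg (by omega),
          hval t (by omega) ht hSt, incr, if_neg (by omega)]
        simp
      · have hSs : D.Touch y s := hsS.resolve_left (by omega)
        have h₁ := edgeSlope_mul (m := nd s) (n := nd t) hq0 (by omega)
        have h₂ : (((t - s : ℕ)) : ℝ) ≠ 0 := by rw [Nat.cast_ne_zero]; omega
        have h₃ := hlin' (t - s) (by omega) (by omega) (by omega)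
        rw [show t - (t - s) = s by omega] at h₃
        rw [hev, startVal, if_neg (by omega), hval s hs0 (by omega) hSs, hts, htt, h₃] at h₁
        apply mul_right_cancel₀ h₂
        linarith
    refine Link.of_line hq (by omega) (fun r h₁ h₂ => ?_) ?_ ?_ ?_
    · rw [hts] at h₁
      rw [htt] at h₂
      have h₃ := hlin' (t - r) (by omega) (by omega) (by omega)
      rw [show t - (t - r) = r by omega] at h₃
      rw [seg, hev, hslope, htt, ← h₃]
      exact hy r (by omega) (by omega)
    · rw [hts, htt, hslope]; exact hstep
    · rw [hts, htt]
      exact fun r h₁ h₂ h => hbet r h₁ h₂ (Or.inl h)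
    · rw [htt]
      exact fun h => Or.inl (htype t (by omega) h)
  · intro s hsT hsS hbet
    have hts := htm s hsT
    have hst : s < D.T + 2 := by omega
    -- The increment beyond the last time is zero by convention, which forces `y` to be constant
    -- after its last touching time.
    have hlast : incr D.T y (D.T + 1) = 0 := by rw [incr, if_neg (by omega)]
    have hstep : ∀ r, 1 ≤ r → s ≤ r → r < D.T + 1 → y (r + 1) - y r = 0 := by
      intro r h₁ h₂ h₃
      have := hincr' s (D.T + 2) hst le_rfl (fun r h h' => hbet r h (by omega))
      have h₄ := (this r h₂ (by omega)).trans (this (D.T + 1) hsT (by omega)).symm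
      rw [hlast, incr, if_pos (by omega)] at h₄
      exact h₄
    have hconst : ∀ r, 1 ≤ r → s ≤ r → r ≤ D.T + 1 → y r = y (D.T + 1) := by
      intro r h₁ h₂ h₃
      have := hlin s (D.T + 1) 0 le_rfl hstep (D.T + 1 - r) (by omega) (by omega) (by omega)
      rw [show D.T + 1 - (D.T + 1 - r) = r by omega] at this
      simpa using this
    have hslope : D.edgeSlope (nd s) D.endNode = 0 := by
      rw [edgeSlope, if_neg hq0, edgeVal, if_neg hq0, if_pos le_rfl]
      simp
    refine Link.of_line hq (by rw [tm_endNode]; omega) (fun r h₁ h₂ => ?_) ?_ ?_ ?_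
    · rw [hts] at h₁
      rw [tm_endNode] at h₂
      rw [seg, hslope, zero_mul, sub_zero, edgeVal, if_neg hq0, if_pos le_rfl]
      rcases Nat.eq_zero_or_pos s with rfl | hs0
      -- `y` touches nothing and is constant. The edge uses the maximum of the lower bounds instead,
      -- which lies below `y` and hence below all upper bounds.
      · rw [startVal, if_pos hts, tgtVal, if_pos le_rfl, blockVal,
          if_neg (by unfold endNode; omega), hts, tm_endNode]
        refine ⟨le_runMax _ _ _ _ h₁ (by omega), runMax_le _ _ _ _ fun r' h₃ h₄ => ?_⟩
        calc D.lo r' ≤ y r' := (hy r' (by omega) (by omega)).1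
          _ = y r := by rw [hconst r' h₃ (by omega) (by omega), hconst r h₁ (by omega) h₂]
          _ ≤ _ := (hy r (by omega) (by omega)).2
      · rw [startVal, if_neg (by omega), hval s hs0 hsT (hsS.resolve_left (by omega)),
          hconst s hs0 le_rfl hsT, ← hconst r (by omega) (by omega) h₂]
        exact hy r (by omega) h₂
    · rw [hts, tm_endNode, hslope]; exact hstep
    · rw [hts, tm_endNode]
      exact fun r h₁ h₂ h => hbet r h₁ h₂.le (Or.inl h)
    · rw [hts, tm_endNode]
      intro _
      rcases hsT.eq_or_lt with h | h
      · exact Or.inr h.ge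
      · exact Or.inl fun h' => hbet (D.T + 1) h le_rfl (Or.inl h')

/-- Every trajectory is matched by a path in the table. -/
theorem Table.complete (hq : D.q = 0 ∨ 1 ≤ D.q) (H : D.Table fl V X) {x : ℕ → ℝ}
    (hx : D.Feas x) {k : ℕ} (hk : k ≤ D.T + 1) (hc : cnt x (D.T + 1) ≤ k) :
    fl D.endNode k ∧ V D.endNode k ≤ D.tcost x (D.T + 1) := by
  rcases hq with hq | hq
  · exact H.complete_zero hq hx hk hc
  · obtain ⟨y, h₁, h₂, h₃, h₄⟩ := exists_smooth hq hx
    obtain ⟨h₅, h₆⟩ := H.complete_of_smooth hq h₁ h₄ hk (h₃.trans hc)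
    exact ⟨h₅, h₆.trans h₂⟩

theorem cnt_le (x : ℕ → ℝ) (t : ℕ) : cnt x t ≤ t := by
  simpa [cnt] using Finset.card_filter_le (Finset.Ioc 0 t) (fun r => x r ≠ 0)

/-! ### The lower envelope -/

/-- The trajectory `x` is optimal for all parameters between `a` and `b`. -/
def OptimalOn (D : Scalar) (a b : ℝ) (x : ℕ → ℝ) : Prop :=
  ∀ γ, 0 ≤ γ → γ ≤ 1 → a ≤ γ → γ ≤ b → D.Feas x ∧ ∀ y, D.Feas y →
    γ * cnt x (D.T + 1) + (1 - γ) * D.tcost x (D.T + 1) ≤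
      γ * cnt y (D.T + 1) + (1 - γ) * D.tcost y (D.T + 1)

/-- The state of the envelope computation after `j` pieces: at the parameter `γ` the budget `k`
is optimal. -/
structure Front (D : Scalar) (A : ℕ → Prop) (W : ℕ → ℝ) (j k : ℕ) (γ : ℝ) : Prop where
  le : k ≤ D.T + 1
  feas : A k
  nonneg : 0 ≤ γ
  le_one : γ ≤ 1
  opt : ∀ k' ≤ D.T + 1, A k' → γ * k + (1 - γ) * W k ≤ γ * k' + (1 - γ) * W k'
  -- Each piece lowers the budget until the parameter is 1. For `j = T + 2` the first alternative is
  -- impossible, so `T + 2` pieces suffice.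
  progress : k + j ≤ D.T + 1 ∨ γ = 1 ∧ ∀ k' < k, ¬ A k'

/-- The parameter at which the budget `k'` becomes as good as the budget `k`. -/
noncomputable def crossing (W : ℕ → ℝ) (k k' : ℕ) : ℝ :=
  (W k' - W k) / ((W k' - W k) + (k - k' : ℕ))

/-- `γ` is the first crossing of the budget `k` with the budgets below `b`, at `k'`. -/
structure FirstCrossing (A : ℕ → Prop) (W : ℕ → ℝ) (k b k' : ℕ) (γ : ℝ) : Prop where
  le : ∀ k'' < b, A k'' → γ ≤ crossing W k k''
  attained : γ = 1 ∧ k' = k ∨ k' < k ∧ A k' ∧ γ = crossing W k k'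

/-- As `γ` grows, lines of larger budgets rise at least as fast as that of `k` and cannot become
better; lines of smaller budgets become better only after their crossings. So `k` stays optimal up
to the first crossing, where `k'` ties with it. -/
theorem Front.next {A : ℕ → Prop} {W : ℕ → ℝ} {j k k' : ℕ} {γ γ' : ℝ}
    (hA : ∀ k k', A k → k ≤ k' → k' ≤ D.T + 1 → W k' ≤ W k)
    (h : D.Front A W j k γ) (hn : FirstCrossing A W k k k' γ') :
    γ ≤ γ' ∧ D.Front A W (j + 1) k' γ' ∧ ∀ δ, γ ≤ δ → δ ≤ γ' → ∀ k'' ≤ D.T + 1, A k'' →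
      δ * k + (1 - δ) * W k ≤ δ * k'' + (1 - δ) * W k'' := by
  have hgap : ∀ k'' < k, A k'' → 0 ≤ W k'' - W k ∧ (0 : ℝ) < (k - k'' : ℕ) ∧
      ((k - k'' : ℕ) : ℝ) = k - k'' := fun k'' h₁ h₂ =>
    ⟨sub_nonneg.2 (hA k'' k h₂ h₁.le h.le), by rw [Nat.cast_pos]; omega, Nat.cast_sub h₁.le⟩
  have hle1 : γ' ≤ 1 := by
    rcases hn.attained with h₁ | ⟨h₁, h₂, h₃⟩
    · exact h₁.1.le
    · obtain ⟨h₄, h₅, _⟩ := hgap k' h₁ h₂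
      rw [h₃, crossing, div_le_one (by linarith)]
      linarith
  have hγ : γ ≤ γ' := by
    rcases hn.attained with h₁ | ⟨h₁, h₂, h₃⟩
    · rw [h₁.1]; exact h.le_one
    · obtain ⟨h₄, h₅, h₆⟩ := hgap k' h₁ h₂
      rw [h₃, crossing, le_div_iff₀ (by linarith), h₆]
      have := h.opt k' (h₁.le.trans h.le) h₂
      linarith
  have hopt : ∀ δ, γ ≤ δ → δ ≤ γ' → ∀ k'' ≤ D.T + 1, A k'' →
      δ * k + (1 - δ) * W k ≤ δ * k'' + (1 - δ) * W k'' := by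
    intro δ h₁ h₂ k'' h₃ h₄
    rcases Nat.lt_or_ge k'' k with h₅ | h₅
    · obtain ⟨h₆, h₇, h₈⟩ := hgap k'' h₅ h₄
      have h₉ := h₂.trans (hn.le k'' h₅ h₄)
      rw [crossing, le_div_iff₀ (by linarith), h₈] at h₉
      linarith
    -- A larger budget: the inequality at `γ` persists, since `W k'' ≤ W k` and `k ≤ k''`.
    · have h₆ := hA k k'' h.feas h₅ h₃
      have h₇ := h.opt k'' h₃ h₄
      have h₈ : (k : ℝ) ≤ k'' := by exact_mod_cast h₅
      nlinarith [mul_nonneg (sub_nonneg.2 h₁) (sub_nonneg.2 h₆),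
        mul_nonneg (sub_nonneg.2 h₁) (sub_nonneg.2 h₈)]
  refine ⟨hγ, ?_, hopt⟩
  rcases hn.attained with ⟨h₁, rfl⟩ | ⟨h₁, h₂, h₃⟩
  · refine ⟨h.le, h.feas, h.nonneg.trans hγ, hle1, hopt γ' hγ le_rfl, Or.inr ⟨h₁, ?_⟩⟩
    intro k'' h₂ h₃
    -- A crossing with a feasible smaller budget is strictly below 1, so if none comes before 1
    -- there is no such budget.
    obtain ⟨h₄, h₅, _⟩ := hgap k'' h₂ h₃
    have := hn.le k'' h₂ h₃
    rw [crossing, le_div_iff₀ (by linarith), h₁] at this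
    linarith
  · refine ⟨h₁.le.trans h.le, h₂, h.nonneg.trans hγ, hle1, fun k'' h₄ h₅ => ?_, ?_⟩
    · refine le_trans (le_of_eq ?_) (hopt γ' hγ le_rfl k'' h₄ h₅)
      obtain ⟨h₆, h₇, h₈⟩ := hgap k' h₁ h₂
      have : γ' * (W k' - W k + (k - k' : ℕ)) = W k' - W k := by
        rw [h₃, crossing, div_mul_cancel₀ _ (by linarith)]
      rw [h₈] at this
      linarith
    · rcases h.progress with h₄ | h₄
      · left; omega
      · exact absurd h₂ (h₄.2 k' h₁)

section

variable (hq : D.q = 0 ∨ 1 ≤ D.q) (H : D.Table fl V X)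
include hq H

/-- The trajectory stored for `k` also competes for the budget `k'`. -/
theorem Table.antitone (k k' : ℕ) (h : fl D.endNode k) (hk : k ≤ k') (hk' : k' ≤ D.T + 1) :
    V D.endNode k' ≤ V D.endNode k := by
  obtain ⟨h₁, h₂, h₃⟩ := H.sound hq (hk.trans hk') h
  exact (H.complete hq h₁ hk' (h₂.trans hk)).2.trans h₃

theorem Table.front_zero (hle : ∀ r, 1 ≤ r → r ≤ D.T + 1 → D.lo r ≤ D.hi r) :
    D.Front (fl D.endNode) (V D.endNode) 0 (D.T + 1) 0 := by
  have hf : D.Feas D.lo := fun r h₁ h₂ => ⟨le_rfl, hle r h₁ h₂⟩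
  refine ⟨le_rfl, (H.complete hq hf le_rfl (cnt_le _ _)).1, le_rfl, zero_le_one, ?_, by simp⟩
  intro k hk h
  have := H.antitone hq k _ h hk le_rfl
  simpa using this

/-- A competitor `y` is compared through the budget `cnt y`: completeness bounds its cost from
below, and soundness bounds the objective of the stored trajectory from above. -/
theorem Table.optimalOn {k : ℕ} {γ γ' : ℝ} (hk : k ≤ D.T + 1) (h : fl D.endNode k)
    (hopt : ∀ δ, γ ≤ δ → δ ≤ γ' → ∀ k' ≤ D.T + 1, fl D.endNode k' →
      δ * k + (1 - δ) * V D.endNode k ≤ δ * k' + (1 - δ) * V D.endNode k') :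
    D.OptimalOn γ γ' (X D.endNode k) := by
  intro δ h₀ h₁ h₂ h₃
  obtain ⟨a₁, a₂, a₃⟩ := H.sound hq hk h
  refine ⟨a₁, fun y hy => ?_⟩
  obtain ⟨b₁, b₂⟩ := H.complete hq hy (cnt_le _ _) le_rfl
  have h₄ := hopt δ h₂ h₃ _ (cnt_le y _) b₁
  have h₅ : (cnt (X D.endNode k) (D.T + 1) : ℝ) ≤ k := by exact_mod_cast a₂
  have h₆ : 0 ≤ 1 - δ := by linarith
  calc _ ≤ δ * k + (1 - δ) * V D.endNode k := by gcongr
    _ ≤ _ := h₄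
    _ ≤ _ := by gcongr

end

theorem OptimalOn.congr {a b : ℝ} {x y : ℕ → ℝ} (h : D.OptimalOn a b x)
    (hxy : ∀ r, 1 ≤ r → r ≤ D.T + 1 → x r = y r) : D.OptimalOn a b y := by
  intro γ h₁ h₂ h₃ h₄
  obtain ⟨h₅, h₆⟩ := h γ h₁ h₂ h₃ h₄
  refine ⟨fun r h₇ h₈ => hxy r h₇ h₈ ▸ h₅ r h₇ h₈, ?_⟩
  rw [← cnt_congr hxy, ← tcost_congr hxy]
  exact h₆

end Scalar

/-! ### Putting the coordinates together -/

/-- Coordinate `i` of an instance, with times `1, …, T + 1`. -/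
noncomputable def coord {p T : ℕ} (q : ℝ) (F : Fin (T + 1) → Fin p → ℝ) (lam : Fin (T + 1) → ℝ)
    (i : Fin p) : Scalar where
  q := q
  T := T
  lo r := if h : r - 1 < T + 1 then F ⟨r - 1, h⟩ i - lam ⟨r - 1, h⟩ else 0
  hi r := if h : r - 1 < T + 1 then F ⟨r - 1, h⟩ i + lam ⟨r - 1, h⟩ else 0

/-- A solution path of the problem of one coordinate. -/
structure Scalar.IsPath (D : Scalar) (m : ℕ) (g : ℕ → ℝ) (x : ℕ → ℕ → ℝ) : Prop where
  first : g 0 = 0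
  last : g m = 1
  mono : ∀ j < m, g j ≤ g (j + 1)
  optimal : ∀ j < m, D.OptimalOn (g j) (g (j + 1)) (fun r => x j (r - 1))

/-- Coordinate `i` of a parameter sequence, with times `1, …, T + 1`. -/
noncomputable def column {p T : ℕ} (θ : Fin (T + 1) → Fin p → ℝ) (i : Fin p) (r : ℕ) : ℝ :=
  if h : r - 1 < T + 1 then θ ⟨r - 1, h⟩ i else 0

/-- `F` and `lam` enter only through `coord`, whose temporal cost depends on `q` alone. -/
theorem objective_eq {p T : ℕ} (q γ : ℝ) (F : Fin (T + 1) → Fin p → ℝ) (lam : Fin (T + 1) → ℝ)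
    (θ : Fin (T + 1) → Fin p → ℝ) :
    objective q γ θ = ∑ i, (γ * (Scalar.cnt (column θ i) (T + 1) : ℝ) +
      (1 - γ) * (coord q F lam i).tcost (column θ i) (T + 1)) := by
  have h₁ : ∑ t, (l0norm (θ t) : ℝ) = ∑ i, (Scalar.cnt (column θ i) (T + 1) : ℝ) := by
    have a (t : Fin (T + 1)) : (l0norm (θ t) : ℝ) = ∑ i, if θ t i ≠ 0 then (1 : ℝ) else 0 := by
      rw [l0norm, Finset.card_filter, Nat.cast_sum]
      simp
    have b (i : Fin p) : (Scalar.cnt (column θ i) (T + 1) : ℝ) =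
        ∑ t : Fin (T + 1), if θ t i ≠ 0 then (1 : ℝ) else 0 := by
      rw [Scalar.cnt, Finset.card_filter, Nat.cast_sum]
      rw [show Finset.Ioc 0 (T + 1) = Finset.Ico 1 (T + 2) by ext; simp; omega,
        Finset.sum_Ico_eq_sum_range, show T + 2 - 1 = T + 1 by omega, Finset.sum_range]
      refine Finset.sum_congr rfl fun t _ => ?_
      have : 1 + (t : ℕ) - 1 < T + 1 := by omega
      rw [column, dif_pos this]
      simp
    rw [Finset.sum_congr rfl fun t _ => a t, Finset.sum_congr rfl fun i _ => b i,
      Finset.sum_comm]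
  have h₂ : ∑ t : Fin T, lqPow q (θ t.succ - θ t.castSucc) =
      ∑ i, (coord q F lam i).tcost (column θ i) (T + 1) := by
    have a (v : Fin p → ℝ) : lqPow q v = ∑ i, penalty q (v i) := by
      unfold lqPow penalty
      split_ifs with h
      · simp [l0norm, Finset.card_filter, ite_not]
      · rfl
    have b (i : Fin p) : (coord q F lam i).tcost (column θ i) (T + 1) =
        ∑ t : Fin T, penalty q ((θ t.succ - θ t.castSucc) i) := by
      rw [Scalar.tcost, Finset.sum_Ico_eq_sum_range, show T + 1 - 1 = T by omega,
        Finset.sum_range]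
      refine Finset.sum_congr rfl fun t _ => ?_
      have e₁ : column θ i (1 + (t : ℕ) + 1) = θ t.succ i := by
        have : 1 + (t : ℕ) + 1 - 1 < T + 1 := by omega
        rw [column, dif_pos this]
        refine congrArg (θ · i) ?_
        ext; simp; omega
      have e₂ : column θ i (1 + (t : ℕ)) = θ t.castSucc i := by
        have : 1 + (t : ℕ) - 1 < T + 1 := by omega
        rw [column, dif_pos this]
        refine congrArg (θ · i) ?_
        ext; simp
      rw [e₁, e₂]
      rfl
    rw [Finset.sum_congr rfl fun t _ => a _, Finset.sum_congr rfl fun i _ => b i,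
      Finset.sum_comm]
  rw [objective, h₁, h₂, Finset.sum_add_distrib, Finset.mul_sum, Finset.mul_sum]

theorem feasible_iff {p T : ℕ} (q : ℝ) (F : Fin (T + 1) → Fin p → ℝ) (lam : Fin (T + 1) → ℝ)
    (hlam : ∀ t, 0 ≤ lam t) (θ : Fin (T + 1) → Fin p → ℝ) :
    θ ∈ feasible F lam ↔ ∀ i, (coord q F lam i).Feas (column θ i) := by
  have : θ ∈ feasible F lam ↔ ∀ i t, F t i - lam t ≤ θ t i ∧ θ t i ≤ F t i + lam t := by
    unfold feasible
    rw [Set.mem_ofPred_eq, forall_comm]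
    refine forall_congr' fun t => ?_
    rw [pi_norm_le_iff_of_nonneg (hlam t)]
    refine forall_congr' fun i => ?_
    rw [Pi.sub_apply, Real.norm_eq_abs, abs_le]
    constructor <;> rintro ⟨h₁, h₂⟩ <;> constructor <;> linarith
  rw [this]
  refine forall_congr' fun i => ⟨fun h r h₁ h₂ => ?_, fun h t => ?_⟩
  · have hr : r - 1 < T + 1 := by simp only [coord] at h₂; omega
    simp only [coord, column, dif_pos hr]
    exact h ⟨r - 1, hr⟩
  · have := h (t + 1) (by omega) (by simp only [coord]; omega)
    have ht : (t : ℕ) + 1 - 1 < T + 1 := by omega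
    simp only [coord, column, dif_pos ht] at this
    simpa only [Nat.add_sub_cancel] using this

/-- Since the problem is separable, the pieces of different coordinates can be combined freely,
without a common refinement of the breakpoints. -/
theorem isSolutionPath_of_coord {p T : ℕ} {q : ℝ} {F : Fin (T + 1) → Fin p → ℝ}
    {lam : Fin (T + 1) → ℝ} (hlam : ∀ t, 0 ≤ lam t) {m : Fin p → ℕ} {g : Fin p → ℕ → ℝ}
    {x : Fin p → ℕ → ℕ → ℝ} (h : ∀ i, (coord q F lam i).IsPath (m i) (g i) (x i)) :
    IsSolutionPath q F lam m g (fun i j t => x i j t) := by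
  refine ⟨fun i => (h i).first, fun i => (h i).last, fun i => (h i).mono, ?_⟩
  intro γ hγ J hJ
  set Θ : Fin (T + 1) → Fin p → ℝ := fun t i => x i (J i) t with hΘ
  have hcol (i : Fin p) (r : ℕ) (h₁ : 1 ≤ r) (h₂ : r ≤ (coord q F lam i).T + 1) :
      x i (J i) (r - 1) = column Θ i r := by
    have hr : r - 1 < T + 1 := by simp only [coord] at h₂; omega
    simp only [column, dif_pos hr, hΘ]
  have hopt := fun i => ((h i).optimal (J i) (hJ i).1).congr (hcol i) γ hγ.1 hγ.2 (hJ i).2.1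
    (hJ i).2.2
  refine ⟨(feasible_iff q F lam hlam _).2 fun i => (hopt i).1, fun θ hθ => ?_⟩
  rw [Set.mem_ofPred_eq, objective_eq q γ F lam, objective_eq q γ F lam]
  exact Finset.sum_le_sum fun i _ => (hopt i).2 _ ((feasible_iff q F lam hlam θ).1 hθ i)

end ProxGL

namespace ProxGL

open RealRAM

/-! ### The program

Index variables: `0, 1` hold `p, T`, `2` the coordinate, `3, 4` two nodes, `5` a time, `6` a budget,
`7` a piece, `8, 9` flags, `10` the best predecessor, `11, 12, 13` budgets in the envelope
computation, `14` a time.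

Index arrays: `1, 2` the times and types of the nodes, `3` the flags of the table, `4, 5` the
admissibility and the weight of the edges into the current node.

Real arrays: `4, 5` the values and trajectories of the table, `6, 7, 8` the cost, the last
value and the slope of the edges into the current node. -/

namespace Program

def lit : ℕ → NExp := .lit
def var : ℕ → NExp := .var
def real : ℕ → RExp := fun n => .ofN (.lit n)
def rvar : ℕ → RExp := .var

def loE (r : NExp) : RExp :=
  .sub (.get 0 (.sub r (lit 1)) (var 2) (lit 0)) (.get 1 (.sub r (lit 1)) (lit 0) (lit 0))
def hiE (r : NExp) : RExp :=
  .add (.get 0 (.sub r (lit 1)) (var 2) (lit 0)) (.get 1 (.sub r (lit 1)) (lit 0) (lit 0))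
def tmE (n : NExp) : NExp := .get 1 n (lit 0) (lit 0)
def tyE (n : NExp) : NExp := .get 2 n (lit 0) (lit 0)
def endE : NExp :=
  .add (.add (.add (var 1) (lit 2)) (.add (var 1) (lit 2))) (.add (var 1) (lit 2))
def flE (n k : NExp) : NExp := .get 3 n k (lit 0)
def valE (n k : NExp) : RExp := .get 4 n k (lit 0)
def trajE (n k r : NExp) : RExp := .get 5 n k r

/-- Writes the times and types of the three nodes of time `14`. -/
def nodeEntry (b : ℕ) : Prog :=
  let n : NExp := .add (.add (.add (var 14) (var 14)) (var 14)) (lit b)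
  -- `t - (t - (T + 1))` with truncated subtraction is the minimum of `t` and `T + 1`.
  .seq (.nput 1 n (lit 0) (lit 0) (.sub (var 14) (.sub (var 14) (.add (var 1) (lit 1)))))
    (.nput 2 n (lit 0) (lit 0) (lit b))

def nodes : Prog :=
  .for 14 (lit 0) (.add (var 1) (lit 3))
    (.seq (nodeEntry 0) (.seq (nodeEntry 1) (nodeEntry 2)))

/-- Computes the maximum of the lower bounds between the nodes `4` and `3`. -/
def maxLo : Prog :=
  .seq (.rset 0 (loE (.add (tmE (var 4)) (lit 1))))
    (.for 5 (.add (tmE (var 4)) (lit 1)) (.add (tmE (var 3)) (lit 1))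
      (.ite (.rle (rvar 0) (loE (var 5))) (.rset 0 (loE (var 5))) .skip))

def nodeVal (n : NExp) (v : ℕ) : Prog :=
  .ite (.nle (lit 2) (tyE n)) (.rset v (real 0))
    (.ite (.nle (lit 1) (tyE n)) (.rset v (hiE (tmE n))) (.rset v (loE (tmE n))))

def blockVal : Prog :=
  .ite (.nle (lit 2) (tyE (var 3))) (.rset 8 (real 0)) (.rset 8 (rvar 0))

def tgtVal : Prog := .ite (.nle endE (var 3)) (.rset 2 (rvar 8)) (nodeVal (var 3) 2)

def startVal : Prog :=
  .ite (.nle (tmE (var 4)) (lit 0)) (.rset 1 (rvar 2)) (nodeVal (var 4) 1)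

def stepsE : NExp := .sub (tmE (var 3)) (tmE (var 4))

def edgeVals : Prog :=
  .ite (.rle (.pen (real 2)) (real 1))
    (.seq (.rset 3 (rvar 8)) (.seq (.rset 4 (real 0))
      (.ite (.and (.not (.nle (tmE (var 4)) (lit 0))) (.and (.not (.nle (tmE (var 3)) (tmE (var 4))))
          (.not (.and (.nle (lit 2) (tyE (var 4))) (.nle (lit 2) (tyE (var 3)))))))
        (.rset 5 (real 1)) (.rset 5 (real 0)))))
    (.seq (.ite (.nle endE (var 3)) (.rset 3 (rvar 1)) (.rset 3 (rvar 2)))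
      (.seq (.rset 4 (.div (.sub (rvar 3) (rvar 1)) (.ofN stepsE)))
        (.rset 5 (.mul (.ofN stepsE) (.pen (rvar 4))))))

def segE : RExp := .sub (rvar 3) (.mul (rvar 4) (.ofN (.sub (tmE (var 3)) (var 5))))

def check : Prog :=
  .seq (.nset 8 (lit 1))
    (.for 5 (.add (tmE (var 4)) (lit 1)) (.add (tmE (var 3)) (lit 1))
      (.ite (.and (.rle (loE (var 5)) segE) (.rle segE (hiE (var 5)))) .skip (.nset 8 (lit 0))))

def storeEdge : Prog :=
  .seq (.nput 4 (var 4) (lit 0) (lit 0) (var 8))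
    -- The truncated difference of the type and 1 is 1 exactly for type 2, the zero node.
    (.seq (.nput 5 (var 4) (lit 0) (lit 0) (.sub stepsE (.sub (tyE (var 3)) (lit 1))))
      (.seq (.rput 6 (var 4) (lit 0) (lit 0) (rvar 5))
        (.seq (.rput 7 (var 4) (lit 0) (lit 0) (rvar 3))
          (.rput 8 (var 4) (lit 0) (lit 0) (rvar 4)))))

/-- Computes the edge from node `4` to node `3`. -/
def edge : Prog :=
  .seq maxLo (.seq blockVal (.seq tgtVal (.seq startVal (.seq edgeVals (.seq check storeEdge)))))

def edges : Prog := .for 4 (lit 0) (.sub (var 3) (tyE (var 3))) edge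

def restE (m : NExp) : NExp := .sub (var 6) (.get 5 m (lit 0) (lit 0))

/-- Finds the best predecessor of node `3` with budget `6`. -/
def best : Prog :=
  .seq (.nset 9 (lit 0))
    (.for 4 (lit 0) (.sub (var 3) (tyE (var 3)))
      (.ite (.and (.nle (lit 1) (.get 4 (var 4) (lit 0) (lit 0)))
          (.and (.nle (.get 5 (var 4) (lit 0) (lit 0)) (var 6))
            (.nle (lit 1) (flE (var 4) (restE (var 4))))))
        (.seq (.rset 5 (.add (valE (var 4) (restE (var 4))) (.get 6 (var 4) (lit 0) (lit 0))))
          (.ite (.and (.nle (lit 1) (var 9)) (.not (.rle (rvar 5) (rvar 6)))) .skip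
            (.seq (.nset 9 (lit 1)) (.seq (.rset 6 (rvar 5)) (.nset 10 (var 4))))))
        .skip))

def storeTraj : Prog :=
  .for 5 (lit 1) (.add (tmE (var 3)) (lit 1))
    (.ite (.nle (var 5) (tmE (var 10)))
      (.rput 5 (var 3) (var 6) (var 5) (trajE (var 10) (restE (var 10)) (var 5)))
      (.rput 5 (var 3) (var 6) (var 5)
        (.sub (.get 7 (var 10) (lit 0) (lit 0))
          (.mul (.get 8 (var 10) (lit 0) (lit 0)) (.ofN (.sub (tmE (var 3)) (var 5)))))))

/-- Computes the entry of the table at node `3` with budget `6`. -/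
def cell : Prog :=
  .seq best (.seq (.nput 3 (var 3) (var 6) (lit 0) (var 9))
    (.seq (.rput 4 (var 3) (var 6) (lit 0) (rvar 6)) storeTraj))

def source : Prog :=
  .for 6 (lit 0) (.add (var 1) (lit 2))
    (.seq (.nput 3 (lit 0) (var 6) (lit 0) (lit 1))
      (.seq (.nput 3 (lit 1) (var 6) (lit 0) (lit 0))
        (.seq (.nput 3 (lit 2) (var 6) (lit 0) (lit 0))
          (.rput 4 (lit 0) (var 6) (lit 0) (real 0)))))

def table : Prog :=
  .seq source (.for 3 (lit 3) (.add endE (lit 1))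
    (.seq edges (.for 6 (lit 0) (.add (var 1) (lit 2)) cell)))

/-- Finds the first budget below `12` that becomes optimal, and the parameter. -/
def crossing : Prog :=
  .seq (.rset 7 (real 1)) (.seq (.nset 13 (var 12))
    (.for 11 (lit 0) (var 12)
      (.ite (.nle (lit 1) (flE endE (var 11)))
        (.seq (.rset 5 (.sub (valE endE (var 11)) (valE endE (var 12))))
          (.seq (.rset 6 (.div (rvar 5) (.add (rvar 5) (.ofN (.sub (var 12) (var 11))))))
            -- Ties pass to the larger candidate budget, which is harmless: equal crossings only
            -- produce pieces of length zero.
            (.ite (.rle (rvar 6) (rvar 7)) (.seq (.rset 7 (rvar 6)) (.nset 13 (var 11))) .skip)))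
        .skip)))

def output : Prog :=
  .for 5 (lit 0) (.add (var 1) (lit 1))
    (.rput 3 (var 2) (var 7) (var 5) (trajE endE (var 12) (.add (var 5) (lit 1))))

def envelope : Prog :=
  .seq (.nput 0 (var 2) (lit 0) (lit 0) (.add (var 1) (lit 2)))
    (.seq (.rput 2 (var 2) (lit 0) (lit 0) (real 0)) (.seq (.nset 12 (.add (var 1) (lit 1)))
      (.for 7 (lit 0) (.add (var 1) (lit 2))
        (.seq crossing (.seq (.rput 2 (var 2) (.add (var 7) (lit 1)) (lit 0) (rvar 7))
          (.seq output (.nset 12 (var 13))))))))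

def coordinate : Prog := .seq nodes (.seq table envelope)

def main : Prog := .for 2 (lit 0) (var 0) coordinate

/-! ### Correctness -/

attribute [local simp] NExp.eval RExp.eval Test.Holds lit var real rvar

/-- The inputs of coordinate `i` are in the memory. -/
structure Input (D : Scalar) (i : ℕ) (s : Store) : Prop where
  eqT : s.nvar 1 = D.T
  eqI : s.nvar 2 = i
  lo : ∀ r, s.rcell (0, r - 1, i, 0) - s.rcell (1, r - 1, 0, 0) = D.lo r
  hi : ∀ r, s.rcell (0, r - 1, i, 0) + s.rcell (1, r - 1, 0, 0) = D.hi r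

/-- The inputs of coordinate `i` and the nodes are in the memory. -/
structure Env (D : Scalar) (i : ℕ) (s : Store) : Prop extends Input D i s where
  tm : ∀ n ≤ D.endNode, s.ncell (1, n, 0, 0) = D.tm n
  ty : ∀ n ≤ D.endNode, s.ncell (2, n, 0, 0) = n % 3

def keepsInput (P : Prog) : Bool := !(P.modN 1 || P.modN 2 || P.modRC 0 || P.modRC 1)
def keepsEnv (P : Prog) : Bool := keepsInput P && !(P.modNC 1 || P.modNC 2)

variable {D : Scalar} {i : ℕ} {s s' : Store} {N : ℕ}

theorem Input.frame {P : Prog} (h : Input D i s) (hF : Frame P s s') (hP : keepsInput P = true) :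
    Input D i s' := by
  simp only [keepsInput, Bool.not_or, Bool.and_eq_true, Bool.not_eq_true'] at hP
  obtain ⟨⟨⟨h₁, h₂⟩, h₃⟩, h₄⟩ := hP
  exact ⟨(hF.n 1 h₁).trans h.eqT, (hF.n 2 h₂).trans h.eqI,
    fun r => by rw [hF.rc 0 h₃, hF.rc 1 h₄]; exact h.lo r,
    fun r => by rw [hF.rc 0 h₃, hF.rc 1 h₄]; exact h.hi r⟩

theorem Env.frame {P : Prog} (h : Env D i s) (hF : Frame P s s') (hP : keepsEnv P = true) :
    Env D i s' := by
  simp only [keepsEnv, Bool.not_or, Bool.and_eq_true, Bool.not_eq_true'] at hP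
  exact ⟨h.toInput.frame hF hP.1, fun n hn => by rw [hF.nc 1 hP.2.1]; exact h.tm n hn,
    fun n hn => by rw [hF.nc 2 hP.2.2]; exact h.ty n hn⟩

theorem Input.eval_loE (h : Input D i s) (e : NExp) :
    (loE e).eval D.q s = D.lo (e.eval s) := by
  simp [loE, h.eqI, h.lo]

theorem Input.eval_hiE (h : Input D i s) (e : NExp) :
    (hiE e).eval D.q s = D.hi (e.eval s) := by
  simp [hiE, h.eqI, h.hi]

theorem Input.eval_endE (h : Input D i s) : endE.eval s = D.endNode := by
  simp [endE, h.eqT, Scalar.endNode]; omega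

theorem Env.eval_tmE (h : Env D i s) (e : NExp) (he : e.eval s ≤ D.endNode) :
    (tmE e).eval s = D.tm (e.eval s) := by
  simp [tmE, h.tm _ he]

theorem Env.eval_tyE (h : Env D i s) (e : NExp) (he : e.eval s ≤ D.endNode) :
    (tyE e).eval s = e.eval s % 3 := by
  simp [tyE, h.ty _ he]

theorem run_nodes (h : Input D i s) (hN : D.T + 3 ≤ N) : Run D.q N nodes s (Env D i) := by
  have key : Run D.q N nodes s (fun s' => ∀ n < 3 * (D.T + 3),
      s'.ncell (1, n, 0, 0) = D.tm n ∧ s'.ncell (2, n, 0, 0) = n % 3) := by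
    refine Run.for (fun t s' => ∀ n < 3 * t,
      s'.ncell (1, n, 0, 0) = D.tm n ∧ s'.ncell (2, n, 0, 0) = n % 3) 0 (D.T + 3) (by simp)
      (by omega) (by omega) rfl (by simp) (fun s' hF => by simp [hF.n 1 rfl, h.eqT]) ?_
    intro t s' _ ht htv hF hI
    have hT : s'.nvar 1 = D.T := (hF.n 1 rfl).trans h.eqT
    refine Run.seq (Run.seq (Run.nput (Run.nput ?_)))
    refine Run.seq (Run.seq (Run.nput (Run.nput ?_)))
    refine Run.seq (Run.nput (Run.nput ?_))
    intro n hn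
    simp [htv, hT]
    by_cases h₁ : n < 3 * t
    · obtain ⟨h₂, h₃⟩ := hI n h₁
      rw [if_neg (by omega), if_neg (by omega), if_neg (by omega), if_neg (by omega),
        if_neg (by omega), if_neg (by omega)]
      exact ⟨h₂, h₃⟩
    · simp only [Scalar.tm]
      constructor <;> split_ifs <;> omega
  refine key.mono fun s' hQ hF => ⟨h.frame hF rfl, fun n hn => (hQ n ?_).1, fun n hn => (hQ n ?_).2⟩
  all_goals unfold Scalar.endNode at hn; omega

/-- The current edge is that from node `m` to node `n`. -/
structure AtEdge (D : Scalar) (i m n : ℕ) (s : Store) : Prop extends Env D i s where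
  hm : s.nvar 4 = m
  hn : s.nvar 3 = n
  hle : n ≤ D.endNode
  hlt : m < n - n % 3

/-! ### Computing the edges into a node. -/

variable {m n k : ℕ}

theorem AtEdge.frame {P : Prog} (h : AtEdge D i m n s) (hF : Frame P s s')
    (hP : keepsEnv P = true) (h₃ : P.modN 3 = false) (h₄ : P.modN 4 = false) :
    AtEdge D i m n s' :=
  ⟨h.toEnv.frame hF hP, (hF.n 4 h₄).trans h.hm, (hF.n 3 h₃).trans h.hn, h.hle, h.hlt⟩

theorem AtEdge.tm₄ (h : AtEdge D i m n s) : (tmE (var 4)).eval s = D.tm m := by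
  have := h.hlt
  have := h.hle
  rw [h.toEnv.eval_tmE _ (by simp [h.hm]; omega)]; simp [h.hm]

theorem AtEdge.tm₃ (h : AtEdge D i m n s) : (tmE (var 3)).eval s = D.tm n := by
  rw [h.toEnv.eval_tmE _ (by simp [h.hn, h.hle])]; simp [h.hn]

theorem AtEdge.ty₄ (h : AtEdge D i m n s) : (tyE (var 4)).eval s = m % 3 := by
  have := h.hlt
  have := h.hle
  rw [h.toEnv.eval_tyE _ (by simp [h.hm]; omega)]; simp [h.hm]

theorem AtEdge.ty₃ (h : AtEdge D i m n s) : (tyE (var 3)).eval s = n % 3 := by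
  rw [h.toEnv.eval_tyE _ (by simp [h.hn, h.hle])]; simp [h.hn]

theorem tm_bound (D : Scalar) (n : ℕ) : D.tm n ≤ D.T + 1 := min_le_right _ _

theorem run_maxLo (h : AtEdge D i m n s) (hN : D.T + 1 ≤ N) : Run D.q N maxLo s
    (fun s' => s'.rvar 0 = runMax D.lo (D.tm m) (D.tm n - (D.tm m + 1))) := by
  have hmn := Scalar.tm_le_of_lt (D := D) h.hlt
  have hb := tm_bound D n
  refine Run.seq (Run.rset ?_)
  have h₁ : AtEdge D i m n (s.setR 0 ((loE (.add (tmE (var 4)) (lit 1))).eval D.q s)) :=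
    h.frame (Exec.rset 0 _ s).frame rfl rfl rfl
  refine (Run.for (fun r s' => s'.rvar 0 = runMax D.lo (D.tm m) (r - (D.tm m + 2)))
    (D.tm m + 1) (D.tm n + 1) ?_ (by omega) (by omega) rfl ?_ ?_ ?_).mono ?_
  · have := h₁.tm₄
    simp only [NExp.eval] at *
    rw [this]; rfl
  · have : D.tm m + 1 - (D.tm m + 2) = 0 := by omega
    simp only [Store.setN_rvar, Store.setR_rvar, h.eval_loE, this, runMax]
    simp only [NExp.eval, h.tm₄]; rfl
  · intro s' hF
    have := (h₁.frame hF rfl rfl rfl).tm₃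
    simp only [NExp.eval] at *
    rw [this]; rfl
  · intro r s' h₂ h₃ hr hF hI
    have hs := h₁.frame hF rfl rfl rfl
    have step : runMax D.lo (D.tm m) (r + 1 - (D.tm m + 2)) =
        max (runMax D.lo (D.tm m) (r - (D.tm m + 2))) (D.lo r) := by
      -- The first iteration compares the initial value with itself; the truncated index stays at 0.
      rcases h₂.eq_or_lt with rfl | h₂
      · rw [show D.tm m + 1 + 1 - (D.tm m + 2) = 0 by omega,
          show D.tm m + 1 - (D.tm m + 2) = 0 by omega]
        simp [runMax]
      · rw [show r + 1 - (D.tm m + 2) = r - (D.tm m + 2) + 1 by omega, runMax]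
        congr 2; omega
    have e : (var 5).eval s' = r := hr
    refine Run.ite (fun hb => Run.rset ?_) (fun hb => Run.skip ?_)
    · simp only [Test.Holds, hs.eval_loE, e] at hb
      have hb' : s'.rvar 0 ≤ D.lo r := hb
      rw [hI] at hb'
      rw [step, max_eq_right hb']
      simp only [Store.setN_rvar, Store.setR_rvar, if_pos, hs.eval_loE, e]
    · simp only [Test.Holds, hs.eval_loE, e] at hb
      rw [Store.setN_rvar, hI, step, max_eq_left]
      have : ¬ s'.rvar 0 ≤ D.lo r := hb
      rw [hI] at this
      exact (not_le.1 this).le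
  · intro s' hI _
    rw [hI]
    congr 1; omega

theorem run_nodeVal (h : Env D i s) (e : NExp) (v : ℕ) (he : e.eval s = n) (hn : n ≤ D.endNode) :
    Run D.q N (nodeVal e v) s (fun s' => s'.rvar v = D.nodeVal n) := by
  have h₁ := h.eval_tyE e (by omega)
  have h₂ := h.eval_tmE e (by omega)
  rw [he] at h₁ h₂
  refine Run.ite (fun hb => Run.rset ?_) (fun hb =>
    Run.ite (fun hb' => Run.rset ?_) (fun hb' => Run.rset ?_))
  · simp only [Test.Holds, h₁, lit, NExp.eval] at hb
    rw [Scalar.nodeVal, if_neg (by omega), if_neg (by omega)]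
    simp
  · simp only [Test.Holds, h₁, lit, NExp.eval] at hb hb'
    rw [Scalar.nodeVal, if_neg (by omega), if_pos (by omega)]
    simp [h.eval_hiE, h₂]
  · simp only [Test.Holds, h₁, lit, NExp.eval] at hb hb'
    rw [Scalar.nodeVal, if_pos (by omega)]
    simp [h.eval_loE, h₂]

theorem run_blockVal (h : AtEdge D i m n s)
    (hM : s.rvar 0 = runMax D.lo (D.tm m) (D.tm n - (D.tm m + 1))) :
    Run D.q N blockVal s (fun s' => s'.rvar 8 = D.blockVal m n) := by
  refine Run.ite (fun hb => Run.rset ?_) (fun hb => Run.rset ?_)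
  · simp only [Test.Holds, h.ty₃, lit, NExp.eval] at hb
    rw [Scalar.blockVal, if_pos (by omega)]
    simp
  · simp only [Test.Holds, h.ty₃, lit, NExp.eval] at hb
    rw [Scalar.blockVal, if_neg (by omega)]
    simp [hM]

theorem run_tgtVal (h : AtEdge D i m n s) (hv : s.rvar 8 = D.blockVal m n) :
    Run D.q N tgtVal s (fun s' => s'.rvar 2 = D.tgtVal m n) := by
  refine Run.ite (fun hb => Run.rset ?_) (fun hb =>
    (run_nodeVal h.toEnv (var 3) 2 h.hn h.hle).mono fun s' hs _ => ?_)
  · simp only [Test.Holds, h.eval_endE, var, NExp.eval, h.hn] at hb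
    rw [Scalar.tgtVal, if_pos hb]
    simp [hv]
  · simp only [Test.Holds, h.eval_endE, var, NExp.eval, h.hn] at hb
    rw [Scalar.tgtVal, if_neg hb, hs]

theorem run_startVal (h : AtEdge D i m n s) (hv : s.rvar 2 = D.tgtVal m n) :
    Run D.q N startVal s (fun s' => s'.rvar 1 = D.startVal m n) := by
  have h₁ := h.hlt
  have h₂ := h.hle
  refine Run.ite (fun hb => Run.rset ?_) (fun hb =>
    (run_nodeVal h.toEnv (var 4) 1 h.hm (by omega)).mono fun s' hs _ => ?_)
  · simp only [Test.Holds, h.tm₄, lit, NExp.eval] at hb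
    rw [Scalar.startVal, if_pos (by omega)]
    simp [hv]
  · simp only [Test.Holds, h.tm₄, lit, NExp.eval] at hb
    rw [Scalar.startVal, if_neg (by omega), hs]

/-- The program does not receive `q`. It recognizes `q = 0` by the penalty of 2, which is 1 in this
case and at least 2 otherwise. -/
theorem penalty_two_le_one_iff {q : ℝ} (hq : q = 0 ∨ 1 ≤ q) : penalty q 2 ≤ 1 ↔ q = 0 := by
  rcases hq with rfl | hq
  · simp [penalty]
  · have h₀ : q ≠ 0 := by linarith
    simp only [penalty, h₀, iff_false, not_le]
    exact Real.one_lt_rpow (by norm_num) (by linarith)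

theorem AtEdge.eval_stepsE (h : AtEdge D i m n s) : stepsE.eval s = D.tm n - D.tm m := by
  unfold stepsE
  rw [NExp.eval, h.tm₃, h.tm₄]

theorem run_edgeVals (hq : D.q = 0 ∨ 1 ≤ D.q) (h : AtEdge D i m n s)
    (h₈ : s.rvar 8 = D.blockVal m n) (h₂ : s.rvar 2 = D.tgtVal m n)
    (h₁ : s.rvar 1 = D.startVal m n) :
    Run D.q N edgeVals s (fun s' => s'.rvar 3 = D.edgeVal m n ∧ s'.rvar 4 = D.edgeSlope m n ∧
      s'.rvar 5 = D.edgeCost m n) := by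
  refine Run.ite (fun hb => ?_) (fun hb => ?_)
  · have hq0 : D.q = 0 := by
      rw [← penalty_two_le_one_iff hq]
      simpa using hb
    refine Run.seq (Run.rset (Run.seq (Run.rset ?_)))
    have hs : AtEdge D i m n ((s.setR 3 ((rvar 8).eval D.q s)).setR 4
        ((real 0).eval D.q (s.setR 3 ((rvar 8).eval D.q s)))) :=
      ⟨⟨⟨h.eqT, h.eqI, h.lo, h.hi⟩, h.tm, h.ty⟩, h.hm, h.hn, h.hle, h.hlt⟩
    refine Run.ite (fun hb => Run.rset ?_) (fun hb => Run.rset ?_)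
    · simp only [Test.Holds, hs.tm₄, hs.tm₃, hs.ty₄, hs.ty₃, lit, NExp.eval] at hb
      rw [Scalar.edgeVal, Scalar.edgeSlope, Scalar.edgeCost, if_pos hq0, if_pos hq0, if_pos hq0,
        if_neg (by omega)]
      simp [h₈]
    · simp only [Test.Holds, hs.tm₄, hs.tm₃, hs.ty₄, hs.ty₃, lit, NExp.eval] at hb
      rw [Scalar.edgeVal, Scalar.edgeSlope, Scalar.edgeCost, if_pos hq0, if_pos hq0, if_pos hq0,
        if_pos (by omega)]
      simp [h₈]
  · have hq0 : D.q ≠ 0 := by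
      rw [Ne, ← penalty_two_le_one_iff hq]
      simpa using hb
    have hv : Run D.q N (.ite (.nle endE (var 3)) (.rset 3 (rvar 1)) (.rset 3 (rvar 2))) s
        (fun s' => s'.rvar 3 = D.edgeVal m n ∧ s'.rvar 1 = D.startVal m n) := by
      rw [Scalar.edgeVal, if_neg hq0]
      refine Run.ite (fun hb => Run.rset ?_) (fun hb => Run.rset ?_)
      · simp only [Test.Holds, h.eval_endE, var, NExp.eval, h.hn] at hb
        rw [if_pos hb]
        simp [h₁]
      · simp only [Test.Holds, h.eval_endE, var, NExp.eval, h.hn] at hb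
        rw [if_neg hb]
        simp [h₁, h₂]
    refine Run.seq (hv.mono fun s₁ ⟨hz, hy⟩ hF => ?_)
    have hs := h.frame hF rfl rfl rfl
    refine Run.seq (Run.rset (Run.rset ?_))
    have hs₂ : AtEdge D i m n (s₁.setR 4
        ((RExp.div (.sub (rvar 3) (rvar 1)) (.ofN stepsE)).eval D.q s₁)) :=
      ⟨⟨⟨hs.eqT, hs.eqI, hs.lo, hs.hi⟩, hs.tm, hs.ty⟩, hs.hm, hs.hn, hs.hle, hs.hlt⟩
    have e₁ := hs.eval_stepsE
    have e₂ := hs₂.eval_stepsE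
    rw [Scalar.edgeCost, if_neg hq0, Scalar.edgeSlope, if_neg hq0]
    simp only [RExp.eval, rvar] at e₂ ⊢
    simp [hz, hy, e₁] at e₂ ⊢
    rw [e₂]
    exact Or.inl rfl

theorem run_check (h : AtEdge D i m n s) (hN : D.T + 1 ≤ N) (h₃ : s.rvar 3 = D.edgeVal m n)
    (h₄ : s.rvar 4 = D.edgeSlope m n) :
    Run D.q N check s (fun s' => 1 ≤ s'.nvar 8 ↔ D.EdgeOk m n) := by
  have hmn := Scalar.tm_le_of_lt (D := D) h.hlt
  have hb := tm_bound D n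
  refine Run.seq (Run.nset ?_)
  have h₁ : AtEdge D i m n (s.setN 8 ((lit 1).eval s)) :=
    h.frame (Exec.nset (q := D.q) 8 _ s).frame rfl rfl rfl
  refine (Run.for (fun r s' => 1 ≤ s'.nvar 8 ↔ ∀ r', D.tm m < r' → r' < r →
      D.lo r' ≤ D.seg m n r' ∧ D.seg m n r' ≤ D.hi r')
    (D.tm m + 1) (D.tm n + 1) ?_ (by omega) (by omega) rfl ?_ ?_ ?_).mono ?_
  · have := h₁.tm₄
    simp only [NExp.eval] at *
    rw [this]; rfl
  · simp
    intro r' _ _; omega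
  · intro s' hF
    have := (h₁.frame hF rfl rfl rfl).tm₃
    simp only [NExp.eval] at *
    rw [this]; rfl
  · intro r s' h₂ h₅ hr hF hI
    have hs := h₁.frame hF rfl rfl rfl
    have e : (var 5).eval s' = r := hr
    have hseg : segE.eval D.q s' = D.seg m n r := by
      have e₁ : s'.rvar 3 = D.edgeVal m n := (hF.r 3 rfl).trans h₃
      have e₂ : s'.rvar 4 = D.edgeSlope m n := (hF.r 4 rfl).trans h₄
      simp only [segE, RExp.eval, NExp.eval, hs.tm₃, e, rvar, e₁, e₂, Scalar.seg]
    have hsplit : (∀ r', D.tm m < r' → r' < r + 1 →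
        D.lo r' ≤ D.seg m n r' ∧ D.seg m n r' ≤ D.hi r') ↔
        (∀ r', D.tm m < r' → r' < r → D.lo r' ≤ D.seg m n r' ∧ D.seg m n r' ≤ D.hi r') ∧
        (D.lo r ≤ D.seg m n r ∧ D.seg m n r ≤ D.hi r) := by
      refine ⟨fun h => ⟨fun r' a b => h r' a (by omega), h r (by omega) (by omega)⟩,
        fun ⟨h, h'⟩ r' a b => ?_⟩
      rcases Nat.lt_or_ge r' r with c | c
      · exact h r' a c
      · rw [show r' = r by omega]; exact h'
    refine Run.ite (fun hb => Run.skip ?_) (fun hb => Run.nset ?_)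
    · simp only [Test.Holds, hs.eval_loE, hs.eval_hiE, hseg, e] at hb
      rw [hsplit, ← hI]
      simp [hb]
    · simp only [Test.Holds, hs.eval_loE, hs.eval_hiE, hseg, e] at hb
      rw [hsplit]
      simp
      intro _ h₁
      by_contra h₂
      exact hb ⟨h₁, not_lt.1 h₂⟩
  · intro s' hI _
    rw [hI]
    exact ⟨fun h r a b => h r a (by omega), fun h r a b => h r a (by omega)⟩

/-- The edge from `m` to `n` is in the memory. -/
structure EdgeEntry (D : Scalar) (n m : ℕ) (s : Store) : Prop where
  ok : 1 ≤ s.ncell (4, m, 0, 0) ↔ D.EdgeOk m n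
  weight : s.ncell (5, m, 0, 0) = D.weight m n
  cost : s.rcell (6, m, 0, 0) = D.edgeCost m n
  val : s.rcell (7, m, 0, 0) = D.edgeVal m n
  slope : s.rcell (8, m, 0, 0) = D.edgeSlope m n

theorem EdgeEntry.frame {P : Prog} (h : EdgeEntry D n m s) (hF : Frame P s s')
    (h₄ : P.modNC 4 = false) (h₅ : P.modNC 5 = false) (h₆ : P.modRC 6 = false)
    (h₇ : P.modRC 7 = false) (h₈ : P.modRC 8 = false) : EdgeEntry D n m s' :=
  ⟨by rw [hF.nc 4 h₄]; exact h.ok, by rw [hF.nc 5 h₅]; exact h.weight,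
    by rw [hF.rc 6 h₆]; exact h.cost, by rw [hF.rc 7 h₇]; exact h.val,
    by rw [hF.rc 8 h₈]; exact h.slope⟩

theorem run_storeEdge (h : AtEdge D i m n s) (h₈ : 1 ≤ s.nvar 8 ↔ D.EdgeOk m n)
    (h₃ : s.rvar 3 = D.edgeVal m n) (h₄ : s.rvar 4 = D.edgeSlope m n)
    (h₅ : s.rvar 5 = D.edgeCost m n) :
    Run D.q N storeEdge s (fun s' => EdgeEntry D n m s' ∧
      ∀ m', m' ≠ m → EdgeEntry D n m' s → EdgeEntry D n m' s') := by
  refine Run.seq (Run.nput (Run.seq (Run.nput (Run.seq (Run.rput (Run.seq (Run.rput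
    (Run.rput ?_))))))))
  have e : AtEdge D i m n (s.putN (4, (var 4).eval s, (lit 0).eval s, (lit 0).eval s)
      ((var 8).eval s)) := h.frame 
      (Exec.nput (q := D.q) 4 (var 4) (lit 0) (lit 0) (var 8) s).frame rfl rfl rfl
  have e₁ := e.eval_stepsE
  have e₂ := e.ty₃
  have hm := h.hm
  simp at e₁ e₂
  refine ⟨⟨?_, ?_, ?_, ?_, ?_⟩, fun m' hm' hE => ⟨?_, ?_, ?_, ?_, ?_⟩⟩
  · simpa [hm] using h₈
  · simp [hm] at e₁ e₂ ⊢
    rw [e₁, e₂, Scalar.weight]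
    split_ifs <;> omega
  · simpa [hm] using h₅
  · simpa [hm] using h₃
  · simpa [hm] using h₄
  · simpa [hm, hm'] using hE.ok
  · simpa [hm, hm'] using hE.weight
  · simpa [hm, hm'] using hE.cost
  · simpa [hm, hm'] using hE.val
  · simpa [hm, hm'] using hE.slope

theorem run_edge (hq : D.q = 0 ∨ 1 ≤ D.q) (h : AtEdge D i m n s) (hN : D.T + 1 ≤ N) :
    Run D.q N edge s (fun s' => EdgeEntry D n m s' ∧
      ∀ m', m' ≠ m → EdgeEntry D n m' s → EdgeEntry D n m' s') := by
  refine Run.seq ((run_maxLo h hN).mono fun s₁ q₁ f₁ => ?_)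
  have h₁ := h.frame f₁ rfl rfl rfl
  refine Run.seq ((run_blockVal h₁ q₁).mono fun s₂ q₂ f₂ => ?_)
  have h₂ := h₁.frame f₂ rfl rfl rfl
  refine Run.seq ((run_tgtVal h₂ q₂).mono fun s₃ q₃ f₃ => ?_)
  have h₃ := h₂.frame f₃ rfl rfl rfl
  refine Run.seq ((run_startVal h₃ q₃).mono fun s₄ q₄ f₄ => ?_)
  have h₄ := h₃.frame f₄ rfl rfl rfl
  refine Run.seq ((run_edgeVals hq h₄ (((f₄.r 8 rfl).trans (f₃.r 8 rfl)).trans q₂)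
    ((f₄.r 2 rfl).trans q₃) q₄).mono fun s₅ ⟨q₅, q₅', q₅''⟩ f₅ => ?_)
  have h₅ := h₄.frame f₅ rfl rfl rfl
  refine Run.seq ((run_check h₅ hN q₅ q₅').mono fun s₆ q₆ f₆ => ?_)
  have h₆ := h₅.frame f₆ rfl rfl rfl
  refine (run_storeEdge h₆ q₆ ((f₆.r 3 rfl).trans q₅) ((f₆.r 4 rfl).trans q₅')
    ((f₆.r 5 rfl).trans q₅'')).mono fun s' ⟨a, b⟩ _ => ⟨a, fun m' hm' hE => b m' hm' ?_⟩
  refine EdgeEntry.frame ?_ f₆ rfl rfl rfl rfl rfl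
  refine EdgeEntry.frame ?_ f₅ rfl rfl rfl rfl rfl
  refine EdgeEntry.frame ?_ f₄ rfl rfl rfl rfl rfl
  refine EdgeEntry.frame ?_ f₃ rfl rfl rfl rfl rfl
  refine EdgeEntry.frame ?_ f₂ rfl rfl rfl rfl rfl
  exact EdgeEntry.frame hE f₁ rfl rfl rfl rfl rfl

theorem run_edges (hq : D.q = 0 ∨ 1 ≤ D.q) (h : Env D i s) (hn : s.nvar 3 = n)
    (hle : n ≤ D.endNode) (hN : 3 * D.T + 10 ≤ N) :
    Run D.q N edges s (fun s' => ∀ m < n - n % 3, EdgeEntry D n m s') := by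
  refine Run.for (fun m s' => ∀ m' < m, EdgeEntry D n m' s') 0 (n - n % 3) (by simp) (by omega)
    (by unfold Scalar.endNode at hle; omega) rfl (by simp) ?_ ?_
  · intro s' hF
    have e : (var 3).eval s' = n := (hF.n 3 rfl).trans hn
    have := (h.frame hF rfl).eval_tyE (var 3) (by omega)
    rw [NExp.eval, this, e]
  · intro m s' _ hm hmv hF hI
    have hs : AtEdge D i m n s' :=
      ⟨h.frame hF rfl, hmv, (hF.n 3 rfl).trans hn, hle, hm⟩
    refine (run_edge hq hs (by omega)).mono fun s'' ⟨a, b⟩ _ m' hm' => ?_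
    have : EdgeEntry D n m' s'' := by
      rcases Nat.lt_or_ge m' m with h | h
      · exact b m' h.ne (hI m' h)
      · rw [show m' = m by omega]; exact a
    exact ⟨this.ok, this.weight, this.cost, this.val, this.slope⟩

end Program

end ProxGL

namespace ProxGL

open RealRAM

namespace Program

@[simp] theorem eval_lit (s : Store) (n : ℕ) : (lit n).eval s = n := rfl
@[simp] theorem eval_var (s : Store) (v : ℕ) : (var v).eval s = s.nvar v := rfl
@[simp] theorem eval_real (q : ℝ) (s : Store) (n : ℕ) : (real n).eval q s = n := rfl
@[simp] theorem eval_rvar (q : ℝ) (s : Store) (v : ℕ) : (rvar v).eval q s = s.rvar v := rfl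

attribute [local simp] NExp.eval RExp.eval Test.Holds

variable {D : Scalar} {i : ℕ} {s s' : Store} {N : ℕ} {m n k : ℕ}

/-! ### The table -/

def flag (s : Store) (n k : ℕ) : Prop := 1 ≤ s.ncell (3, n, k, 0)
def val (s : Store) (n k : ℕ) : ℝ := s.rcell (4, n, k, 0)
def traj (s : Store) (n k r : ℕ) : ℝ := s.rcell (5, n, k, r)

/-- Two memories agree on the entry of the table at `n, k`. -/
structure SameAt (s s' : Store) (n k : ℕ) : Prop where
  flag : s'.ncell (3, n, k, 0) = s.ncell (3, n, k, 0)
  val : s'.rcell (4, n, k, 0) = s.rcell (4, n, k, 0)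
  traj : ∀ r, s'.rcell (5, n, k, r) = s.rcell (5, n, k, r)

theorem SameAt.trans {s'' : Store} (h : SameAt s s' n k) (h' : SameAt s' s'' n k) :
    SameAt s s'' n k :=
  ⟨h'.flag.trans h.flag, h'.val.trans h.val, fun r => (h'.traj r).trans (h.traj r)⟩

def keepsTable (P : Prog) : Bool := !(P.modNC 3 || P.modRC 4 || P.modRC 5)

theorem sameAt_of_frame {P : Prog} (hF : Frame P s s') (hP : keepsTable P = true) (n k : ℕ) :
    SameAt s s' n k := by
  simp only [keepsTable, Bool.not_or, Bool.and_eq_true, Bool.not_eq_true'] at hP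
  exact ⟨hF.nc 3 hP.1.1 _, hF.rc 4 hP.1.2 _, fun r => hF.rc 5 hP.2 _⟩

/-- The equation of a cell refers only to itself and to earlier nodes, so it survives all later
writes. -/
theorem cell_congr (h : D.Cell (flag s) (val s) (traj s) n k)
    (hs : ∀ m k', m < n ∨ (m = n ∧ k' = k) → SameAt s s' m k') :
    D.Cell (flag s') (val s') (traj s') n k := by
  have hf : ∀ m k', m < n ∨ (m = n ∧ k' = k) → (flag s' m k' ↔ flag s m k') := fun m k' h => by
    rw [flag, flag, (hs m k' h).flag]
  have hv : ∀ m k', m < n ∨ (m = n ∧ k' = k) → val s' m k' = val s m k' :=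
    fun m k' h => (hs m k' h).val
  have ht : ∀ m k', m < n ∨ (m = n ∧ k' = k) → ∀ r, traj s' m k' r = traj s m k' r :=
    fun m k' h => (hs m k' h).traj
  constructor
  · intro h₁
    obtain ⟨m, hm, ⟨c₁, c₂, c₃⟩, hV, hX⟩ := h.attained ((hf n k (Or.inr ⟨rfl, rfl⟩)).1 h₁)
    refine ⟨m, hm, ⟨c₁, c₂, (hf _ _ (Or.inl (by omega))).2 c₃⟩, ?_, fun r h₂ h₃ => ?_⟩
    · rw [hv n k (Or.inr ⟨rfl, rfl⟩), hv _ _ (Or.inl (by omega)), hV]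
    · rw [ht n k (Or.inr ⟨rfl, rfl⟩), ht _ _ (Or.inl (by omega)), hX r h₂ h₃]
  · rintro m hm ⟨c₁, c₂, c₃⟩
    obtain ⟨h₁, h₂⟩ := h.bound m hm ⟨c₁, c₂, (hf _ _ (Or.inl (by omega))).1 c₃⟩
    rw [hf n k (Or.inr ⟨rfl, rfl⟩), hv n k (Or.inr ⟨rfl, rfl⟩), hv _ _ (Or.inl (by omega))]
    exact ⟨h₁, h₂⟩

/-- The current entry of the table is that at node `n` with budget `k`. -/
structure AtCell (D : Scalar) (i n k : ℕ) (s : Store) : Prop extends Env D i s where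
  hn : s.nvar 3 = n
  hk : s.nvar 6 = k
  hle : n ≤ D.endNode
  entry : ∀ m < n - n % 3, EdgeEntry D n m s

def keepsCell (P : Prog) : Bool :=
  keepsEnv P && !(P.modN 3 || P.modN 6 || P.modNC 4 || P.modNC 5 || P.modRC 6 || P.modRC 7 ||
    P.modRC 8)

theorem AtCell.frame {P : Prog} (h : AtCell D i n k s) (hF : Frame P s s')
    (hP : keepsCell P = true) : AtCell D i n k s' := by
  simp only [keepsCell, Bool.not_or, Bool.and_eq_true, Bool.not_eq_true'] at hP
  obtain ⟨h₀, ⟨⟨⟨⟨⟨h₁, h₂⟩, h₃⟩, h₄⟩, h₅⟩, h₆⟩, h₇⟩ := hP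
  exact ⟨h.toEnv.frame hF h₀, (hF.n 3 h₁).trans h.hn, (hF.n 6 h₂).trans h.hk, h.hle,
    fun m hm => (h.entry m hm).frame hF h₃ h₄ h₅ h₆ h₇⟩

theorem AtCell.tm₃ (h : AtCell D i n k s) : (tmE (var 3)).eval s = D.tm n := by
  rw [h.toEnv.eval_tmE _ (by simp [h.hn, h.hle])]; simp [h.hn]

theorem AtCell.eval_pred (h : AtCell D i n k s) :
    (NExp.sub (var 3) (tyE (var 3))).eval s = n - n % 3 := by
  have e : (var 3).eval s = n := h.hn
  rw [NExp.eval, h.toEnv.eval_tyE _ (by rw [e]; exact h.hle), e]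

theorem run_best (h : AtCell D i n k s) (hN : 3 * D.T + 10 ≤ N) : Run D.q N best s (fun s' =>
    (1 ≤ s'.nvar 9 → ∃ m < n - n % 3, D.Cand (flag s) n k m ∧ s'.nvar 10 = m ∧
      s'.rvar 6 = val s m (k - D.weight m n) + D.edgeCost m n) ∧
    ∀ m < n - n % 3, D.Cand (flag s) n k m →
      1 ≤ s'.nvar 9 ∧ s'.rvar 6 ≤ val s m (k - D.weight m n) + D.edgeCost m n) := by
  refine Run.seq (Run.nset ?_)
  have h₁ : AtCell D i n k (s.setN 9 ((lit 0).eval s)) :=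
    h.frame (Exec.nset (q := D.q) 9 _ s).frame rfl
  refine Run.for (fun b s' =>
    (1 ≤ s'.nvar 9 → ∃ m < b, D.Cand (flag s) n k m ∧ s'.nvar 10 = m ∧
      s'.rvar 6 = val s m (k - D.weight m n) + D.edgeCost m n) ∧
    ∀ m < b, D.Cand (flag s) n k m →
      1 ≤ s'.nvar 9 ∧ s'.rvar 6 ≤ val s m (k - D.weight m n) + D.edgeCost m n)
    0 (n - n % 3) (by simp) (by omega) (by have := h.hle; unfold Scalar.endNode at this; omega)
    rfl (by simp) (fun s' hF => (h₁.frame hF rfl).eval_pred) ?_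
  intro b s' _ hb hbv hF ⟨hI₁, hI₂⟩
  have hs := h₁.frame hF rfl
  have hE := hs.entry b hb
  have hk := hs.hk
  have hsame : SameAt s s' b (k - D.weight b n) :=
    (sameAt_of_frame (Exec.nset (q := D.q) 9 _ s).frame rfl _ _).trans (sameAt_of_frame hF rfl _ _)
  have hrest : (restE (var 4)).eval s' = k - D.weight b n := by
    simp [restE, hbv, hk, hE.weight]
  have hcand : (Test.and (.nle (lit 1) (.get 4 (var 4) (lit 0)
      (lit 0))) (.and (.nle (.get 5 (var 4) (lit 0) (lit 0))
      (var 6)) (.nle (lit 1) (flE (var 4) (restE (var 4)))))).Holds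
      D.q s' ↔ D.Cand (flag s) n k b := by
    rw [Scalar.Cand, ← hE.ok, ← hE.weight, flag, hE.weight, ← hsame.flag]
    simp [flE, hrest, hbv, hk, hE.weight]
  refine Run.ite (fun hc => ?_) (fun hc => Run.skip ?_)
  · rw [hcand] at hc
    refine Run.seq (Run.rset ?_)
    have hval : (RExp.add (valE (var 4) (restE (var 4)))
        (.get 6 (var 4) (lit 0) (lit 0))).eval D.q s' =
        val s b (k - D.weight b n) + D.edgeCost b n := by
      simp [valE, hrest, hbv, hE.cost, val, hsame.val]
    rw [hval]
    refine Run.ite (fun ht => Run.skip ?_)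
      (fun ht => Run.seq (Run.nset (Run.seq (Run.rset (Run.nset ?_)))))
    · simp at ht ⊢
      refine ⟨fun h => ?_, fun m hm hm' => ?_⟩
      · obtain ⟨m, hm, h₁, rfl, h₂⟩ := hI₁ h
        exact ⟨by omega, h₁, h₂⟩
      · rcases Nat.lt_or_ge m b with h | h
        · exact hI₂ m h hm'
        · rw [show m = b by omega]
          exact ⟨ht.1, ht.2.le⟩
    · simp at ht ⊢
      rw [hbv]
      refine ⟨⟨le_rfl, hc, rfl⟩, fun m hm hm' => ?_⟩
      rcases Nat.lt_or_ge m b with h | h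
      · obtain ⟨h₂, h₃⟩ := hI₂ m h hm'
        exact (ht h₂).trans h₃
      · rw [show m = b by omega]
  · rw [hcand] at hc
    simp only [Store.setN_nvar, Store.setN_rvar]
    simp
    refine ⟨fun h => ?_, fun m hm hm' => ?_⟩
    · obtain ⟨m, hm, h₁, rfl, h₂⟩ := hI₁ h
      exact ⟨by omega, h₁, h₂⟩
    · rcases Nat.lt_or_ge m b with h | h
      · exact hI₂ m h hm'
      · rw [show m = b by omega] at hm'
        exact absurd hm' hc

/-- If no predecessor was found, variable 10 need not hold a meaningful node and what is written is
irrelevant. Hence the contents are described only for a genuine predecessor, while the rest of the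
table is untouched in any case. -/
theorem run_storeTraj (h : AtCell D i n k s) (hN : 3 * D.T + 10 ≤ N) :
    Run D.q N storeTraj s (fun s' =>
      (∀ n' k' r, n' ≠ n ∨ k' ≠ k → s'.rcell (5, n', k', r) = s.rcell (5, n', k', r)) ∧
      ∀ b < n - n % 3, s.nvar 10 = b → ∀ r, 1 ≤ r → r ≤ D.tm n → s'.rcell (5, n, k, r) =
        if r ≤ D.tm b then s.rcell (5, b, k - D.weight b n, r) else D.seg b n r) := by
  have htn := tm_bound D n
  refine (Run.for (fun r s' =>
      (∀ n' k' r, n' ≠ n ∨ k' ≠ k → s'.rcell (5, n', k', r) = s.rcell (5, n', k', r)) ∧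
      ∀ b < n - n % 3, s.nvar 10 = b → ∀ r', 1 ≤ r' → r' < r → s'.rcell (5, n, k, r') =
        if r' ≤ D.tm b then s.rcell (5, b, k - D.weight b n, r') else D.seg b n r')
    1 (D.tm n + 1) (by simp) (by omega) (by omega) rfl ?_ ?_ ?_).mono ?_
  · refine ⟨fun _ _ _ _ => rfl, fun b _ _ r' h₁ h₂ => by omega⟩
  · intro s' hF
    have := (h.frame hF rfl).tm₃
    simp only [NExp.eval, eval_lit, this]
  · intro r s' h₁ h₂ hr hF ⟨hI₁, hI₂⟩
    have hs := h.frame hF rfl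
    have hn := hs.hn
    have hk := hs.hk
    have h10 : s'.nvar 10 = s.nvar 10 := hF.n 10 rfl
    have htm (b : ℕ) (hb : b < n - n % 3) (hb' : s.nvar 10 = b) :
        (tmE (var 10)).eval s' = D.tm b := by
      have e : (var 10).eval s' = b := h10.trans hb'
      have := h.hle
      rw [hs.toEnv.eval_tmE _ (by omega), e]
    refine Run.ite (fun ht => Run.rput ?_) (fun ht => Run.rput ?_)
    · refine ⟨fun n' k' r' hne => ?_, fun b hb hb' r' h₃ h₄ => ?_⟩
      · rw [← hI₁ n' k' r' hne]
        simp [hn, hk]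
        intro e₁ e₂
        omega
      · have hE := hs.entry b hb
        simp only [Test.Holds, htm b hb hb'] at ht
        simp [hr] at ht
        rcases Nat.lt_or_ge r' r with h₅ | h₅
        · rw [← hI₂ b hb hb' r' h₃ h₅]
          simp [hn, hk, hr]
          omega
        · rw [show r' = r by omega, if_pos ht]
          have hw : (restE (var 10)).eval s' = k - D.weight b n := by
            simp [restE, h10, hb', hk, hE.weight]
          simp [hn, hk, hr, trajE, hw, h10, hb']
          apply hI₁
          left; omega
    · refine ⟨fun n' k' r' hne => ?_, fun b hb hb' r' h₃ h₄ => ?_⟩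
      · rw [← hI₁ n' k' r' hne]
        simp [hn, hk]
        intro e₁ e₂
        omega
      · have hE := hs.entry b hb
        simp only [Test.Holds, htm b hb hb'] at ht
        simp [hr] at ht
        rcases Nat.lt_or_ge r' r with h₅ | h₅
        · rw [← hI₂ b hb hb' r' h₃ h₅]
          simp [hn, hk, hr]
          omega
        · rw [show r' = r by omega, if_neg (by omega)]
          have e := hs.tm₃
          simp [hn, hk, hr, h10, hb', hE.val, hE.slope, e, Scalar.seg]
  · rintro s' ⟨a, b⟩ _
    exact ⟨a, fun c hc hc' r h₁ h₂ => b c hc hc' r h₁ (by omega)⟩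

theorem run_cell (h : AtCell D i n k s) (hN : 3 * D.T + 10 ≤ N) :
    Run D.q N cell s (fun s' => D.Cell (flag s') (val s') (traj s') n k ∧
      ∀ n' k', n' ≠ n ∨ k' ≠ k → SameAt s s' n' k') := by
  refine Run.seq ((run_best h hN).mono fun s₁ ⟨a₁, a₂⟩ f₁ => ?_)
  have h₁ := h.frame f₁ rfl
  refine Run.seq (Run.nput (Run.seq (Run.rput ?_)))
  have key : ∃ s₂, s₂ = (s₁.putN (3, (var 3).eval s₁, (var 6).eval s₁,
      (lit 0).eval s₁) ((var 9).eval s₁)) := ⟨_, rfl⟩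
  obtain ⟨s₂, e₂⟩ := key
  rw [← e₂]
  have f₂ : Frame (.nput 3 (var 3) (var 6) (lit 0) (var 9)) s₁ s₂ :=
    e₂ ▸ (Exec.nput (q := D.q) 3 _ _ _ _ s₁).frame
  have h₂ := h₁.frame f₂ rfl
  have key : ∃ s₃, s₃ = (s₂.putR (4, (var 3).eval s₂, (var 6).eval s₂,
      (lit 0).eval s₂) ((rvar 6).eval D.q s₂)) := ⟨_, rfl⟩
  obtain ⟨s₃, e₃⟩ := key
  rw [← e₃]
  have f₃ : Frame (.rput 4 (var 3) (var 6) (lit 0) (rvar 6)) s₂ s₃ :=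
    e₃ ▸ (Exec.rput (q := D.q) 4 _ _ _ _ s₂).frame
  have h₃ := h₂.frame f₃ rfl
  refine (run_storeTraj h₃ hN).mono fun s₄ ⟨b₁, b₂⟩ f₄ => ?_
  have hn₁ := h₁.hn
  have hk₁ := h₁.hk
  have hsame : ∀ n' k', n' ≠ n ∨ k' ≠ k → SameAt s s₄ n' k' := by
    intro n' k' hne
    have hne' : ¬ (n' = n ∧ k' = k) := by omega
    refine ⟨?_, ?_, fun r => ?_⟩
    · rw [f₄.nc 3 rfl, e₃, e₂]
      simp [hn₁, hk₁, hne']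
      exact f₁.nc 3 rfl _
    · rw [f₄.rc 4 rfl, e₃, e₂]
      simp [hn₁, hk₁, hne']
      exact f₁.rc 4 rfl _
    · rw [b₁ n' k' r hne, e₃, e₂]
      simp
      exact f₁.rc 5 rfl _
  have hflag : flag s₄ n k ↔ 1 ≤ s₁.nvar 9 := by
    rw [flag, f₄.nc 3 rfl, e₃, e₂]
    simp [hn₁, hk₁]
  have hval : val s₄ n k = s₁.rvar 6 := by
    rw [val, f₄.rc 4 rfl, e₃, e₂]
    simp [hn₁, hk₁]
  have hcand : ∀ m < n - n % 3, (D.Cand (flag s₄) n k m ↔ D.Cand (flag s) n k m) := by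
    intro m hm
    unfold Scalar.Cand flag
    rw [(hsame m (k - D.weight m n) (Or.inl (by omega))).flag]
  have hval' : ∀ m < n - n % 3, ∀ k', val s₄ m k' = val s m k' := fun m hm k' =>
    (hsame m k' (Or.inl (by omega))).val
  refine ⟨⟨fun hf => ?_, fun m hm hc => ?_⟩, hsame⟩
  · obtain ⟨m, hm, hc, hbm, hv⟩ := a₁ (hflag.1 hf)
    refine ⟨m, hm, (hcand m hm).2 hc, by rw [hval, hval' m hm, hv], fun r c₁ c₂ => ?_⟩
    have h10 : s₃.nvar 10 = m := by rw [e₃, e₂]; simpa using hbm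
    have hX := b₂ m hm h10 r c₁ c₂
    have hX' : s₃.rcell (5, m, k - D.weight m n, r) = s₄.rcell (5, m, k - D.weight m n, r) :=
      (b₁ _ _ _ (Or.inl (by omega))).symm
    rw [hX'] at hX
    exact hX
  · rw [hflag, hval, hval' m hm]
    exact a₂ m hm ((hcand m hm).1 hc)

theorem run_source (h : Env D i s) (hN : 3 * D.T + 10 ≤ N) : Run D.q N source s (fun s' =>
    ∀ k < D.T + 2, flag s' 0 k ∧ val s' 0 k = 0 ∧ ¬ flag s' 1 k ∧ ¬ flag s' 2 k) := by
  refine Run.for (fun b s' =>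
    ∀ k < b, flag s' 0 k ∧ val s' 0 k = 0 ∧ ¬ flag s' 1 k ∧ ¬ flag s' 2 k)
    0 (D.T + 2) (by simp) (by omega) (by omega) rfl (by simp)
    (fun s' hF => by simp [hF.n 1 rfl, h.eqT]) ?_
  intro b s' _ hb hbv hF hI
  refine Run.seq (Run.nput (Run.seq (Run.nput (Run.seq (Run.nput (Run.rput ?_))))))
  intro k hk
  simp [flag, val, hbv] at hI ⊢
  by_cases hkb : k = b
  · simp [hkb]
  · simp [hkb]
    exact hI k (by omega)

/-- The memory holds the complete table. -/
def HasTable (D : Scalar) (s : Store) : Prop := D.Table (flag s) (val s) (traj s)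

theorem run_table (hq : D.q = 0 ∨ 1 ≤ D.q) (h : Env D i s) (hN : 3 * D.T + 10 ≤ N) :
    Run D.q N table s (HasTable D) := by
  refine Run.seq ((run_source h hN).mono fun s₁ q₁ f₁ => ?_)
  have h₁ := h.frame f₁ rfl
  refine (Run.for (fun n s' =>
    (∀ k < D.T + 2, flag s' 0 k ∧ val s' 0 k = 0 ∧ ¬ flag s' 1 k ∧ ¬ flag s' 2 k) ∧
    ∀ n', 3 ≤ n' → n' < n → ∀ k < D.T + 2, D.Cell (flag s') (val s') (traj s') n' k)
    3 (D.endNode + 1) (by simp) (by unfold Scalar.endNode; omega)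
    (by unfold Scalar.endNode; omega) rfl ?_ ?_ ?_).mono ?_
  · refine ⟨q₁, fun n' a b => by omega⟩
  · intro s' hF
    have := (h₁.frame hF rfl).eval_endE
    simp only [NExp.eval, eval_lit, this]
  · intro n s₂ hn3 hnE hn f₂ ⟨hI₁, hI₂⟩
    have h₂ := h₁.frame f₂ rfl
    refine Run.seq ((run_edges hq h₂ hn (by omega) hN).mono fun s₃ q₃ f₃ => ?_)
    have h₃ : Env D i s₃ := h₂.frame f₃ rfl
    have hn₃ : s₃.nvar 3 = n := (f₃.n 3 rfl).trans hn
    have key : Run D.q N (.for 6 (lit 0) (.add (var 1) (lit 2)) cell) s₃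
        (fun s' => (∀ k < D.T + 2, D.Cell (flag s') (val s') (traj s') n k) ∧
          ∀ n' < n, ∀ k, SameAt s₃ s' n' k) := by
      refine Run.for (fun b s' => (∀ k < b, D.Cell (flag s') (val s') (traj s') n k) ∧
          ∀ n' < n, ∀ k, SameAt s₃ s' n' k) 0 (D.T + 2) (by simp) (by omega) (by omega) rfl ?_
          (fun s' hF => by simp [hF.n 1 rfl, h₃.eqT]) ?_
      · exact ⟨fun k hk => by omega, fun n' _ k => ⟨rfl, rfl, fun _ => rfl⟩⟩
      · intro b s₄ _ hb hbv f₄ ⟨hJ₁, hJ₂⟩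
        have h₄ : AtCell D i n b s₄ := ⟨h₃.frame f₄ rfl, (f₄.n 3 rfl).trans hn₃, hbv, by omega,
          fun m hm => (q₃ m hm).frame f₄ rfl rfl rfl rfl rfl⟩
        refine (run_cell h₄ hN).mono fun s₅ ⟨a₁, a₂⟩ _ => ?_
        have a₁' : D.Cell (flag (s₅.setN 6 (b + 1))) (val (s₅.setN 6 (b + 1)))
          (traj (s₅.setN 6 (b + 1))) n b := a₁
        refine ⟨fun k hk => ?_, fun n' hn' k => (hJ₂ n' hn' k).trans ?_⟩
        · rcases Nat.lt_or_ge k b with hkb | hkb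
          · refine cell_congr (hJ₁ k hkb) fun m k' hm => ?_
            have := a₂ m k' (by omega)
            exact ⟨this.flag, this.val, this.traj⟩
          · rw [show k = b by omega]; exact a₁'
        · have := a₂ n' k (by omega)
          exact ⟨this.flag, this.val, this.traj⟩
    refine key.mono fun s₄ ⟨a₁, a₂⟩ _ => ?_
    have hs : ∀ n' < n, ∀ k, SameAt s₂ (s₄.setN 3 (n + 1)) n' k := fun n' hn' k =>
      (sameAt_of_frame f₃ rfl _ _).trans
        ⟨(a₂ n' hn' k).flag, (a₂ n' hn' k).val, (a₂ n' hn' k).traj⟩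
    refine ⟨fun k hk => ?_, fun n' c₁ c₂ k hk => ?_⟩
    · have := hI₁ k hk
      unfold flag val at *
      rw [(hs 0 (by omega) k).flag, (hs 0 (by omega) k).val, (hs 1 (by omega) k).flag,
        (hs 2 (by omega) k).flag]
      exact this
    · rcases Nat.lt_or_ge n' n with c₃ | c₃
      · exact cell_congr (hI₂ n' c₁ c₃ k hk) fun m k' hm => hs m (by omega) k'
      · rw [show n' = n by omega]; exact a₁ k hk
  · rintro s' ⟨a, b⟩ _
    exact ⟨fun k hk => ⟨(a k (by omega)).1, (a k (by omega)).2.1⟩,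
      fun k hk => (a k (by omega)).2.2, fun n c₁ c₂ k hk => b n c₁ (by omega) k (by omega)⟩

/-! ### The envelope -/

theorem run_crossing (h : Env D i s) (hk : s.nvar 12 = k) (hkT : k ≤ D.T + 1)
    (hN : 3 * D.T + 10 ≤ N) : Run D.q N crossing s (fun s' =>
      Scalar.FirstCrossing (flag s D.endNode) (val s D.endNode) k k (s'.nvar 13) (s'.rvar 7)) := by
  refine Run.seq (Run.rset (Run.seq (Run.nset ?_)))
  refine Run.for (fun b s' =>
      Scalar.FirstCrossing (flag s D.endNode) (val s D.endNode) k b (s'.nvar 13) (s'.rvar 7))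
    0 k (by simp) (by omega) (by omega) rfl ?_ (fun s' hF => ?_) ?_
  · refine ⟨fun _ h => by omega, Or.inl ?_⟩
    simp [hk]
  · have := hF.n 12 rfl
    simpa [hk] using this
  intro b s' _ hb hbv hF hI
  have hT : s'.nvar 1 = D.T := (hF.n 1 rfl).trans h.eqT
  have h12 : s'.nvar 12 = k := (hF.n 12 rfl).trans hk
  have hE : endE.eval s' = D.endNode := by simp [endE, hT, Scalar.endNode]; omega
  have e₃ : s'.ncell (3, D.endNode, b, 0) = s.ncell (3, D.endNode, b, 0) := hF.nc 3 rfl _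
  have e₄ : ∀ b, s'.rcell (4, D.endNode, b, 0) = s.rcell (4, D.endNode, b, 0) :=
    fun b => hF.rc 4 rfl _
  refine Run.ite (fun hc => ?_) (fun hc => Run.skip ?_)
  · have hf : flag s D.endNode b := by
      simp [flE, hE, hbv, e₃] at hc
      exact hc
    refine Run.seq (Run.rset (Run.seq (Run.rset ?_)))
    have hv : (RExp.sub (valE endE (var 11)) (valE endE (var 12))).eval D.q s' =
        val s D.endNode b - val s D.endNode k := by
      simp [valE, hE, hbv, h12, e₄, val]
    rw [hv]
    refine Run.ite (fun ht => Run.seq (Run.rset (Run.nset ?_))) (fun ht => Run.skip ?_)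
    · simp [h12, hbv] at ht ⊢
      refine ⟨fun k'' hk'' hf'' => ?_, Or.inr ⟨hb, hf, rfl⟩⟩
      rcases Nat.lt_or_ge k'' b with h₁ | h₁
      · exact ht.trans (hI.le k'' h₁ hf'')
      · rw [show k'' = b by omega]; exact le_rfl
    · simp [h12, hbv] at ht ⊢
      refine ⟨fun k'' hk'' hf'' => ?_, hI.attained⟩
      rcases Nat.lt_or_ge k'' b with h₁ | h₁
      · exact hI.le k'' h₁ hf''
      · rw [show k'' = b by omega]; exact ht.le
  · have hf : ¬ flag s D.endNode b := by
      simp [flE, hE, hbv, e₃] at hc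
      simp [flag, hc]
    refine ⟨fun k'' hk'' hf'' => ?_, hI.attained⟩
    rcases Nat.lt_or_ge k'' b with h₁ | h₁
    · exact hI.le k'' h₁ hf''
    · rw [show k'' = b by omega] at hf''; exact absurd hf'' hf

theorem run_output {j : ℕ} (h : Env D i s) (hk : s.nvar 12 = k) (hj : s.nvar 7 = j)
    (hN : 3 * D.T + 10 ≤ N) : Run D.q N output s (fun s' =>
      (∀ r < D.T + 1, s'.rcell (3, i, j, r) = traj s D.endNode k (r + 1)) ∧
      ∀ i' j' r, i' ≠ i ∨ j' ≠ j → s'.rcell (3, i', j', r) = s.rcell (3, i', j', r)) := by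
  refine Run.for (fun b s' =>
      (∀ r < b, s'.rcell (3, i, j, r) = traj s D.endNode k (r + 1)) ∧
      ∀ i' j' r, i' ≠ i ∨ j' ≠ j → s'.rcell (3, i', j', r) = s.rcell (3, i', j', r))
    0 (D.T + 1) (by simp) (by omega) (by omega) rfl (by simp)
    (fun s' hF => by simp [hF.n 1 rfl, h.eqT]) ?_
  intro b s' _ hb hbv hF ⟨hI₁, hI₂⟩
  have hT : s'.nvar 1 = D.T := (hF.n 1 rfl).trans h.eqT
  have hi : s'.nvar 2 = i := (hF.n 2 rfl).trans h.eqI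
  have h12 : s'.nvar 12 = k := (hF.n 12 rfl).trans hk
  have h7 : s'.nvar 7 = j := (hF.n 7 rfl).trans hj
  have hE : endE.eval s' = D.endNode := by simp [endE, hT, Scalar.endNode]; omega
  refine Run.rput ⟨fun r hr => ?_, fun i' j' r hne => ?_⟩
  · rcases Nat.lt_or_ge r b with h₁ | h₁
    · rw [← hI₁ r h₁]
      simp [hbv, hi, h7]
      omega
    · rw [show r = b by omega]
      simp [hbv, hi, h7, trajE, hE, h12]
      exact hF.rc 5 rfl _
  · rw [← hI₂ i' j' r hne]
    simp [hi, h7]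
    intro a b
    omega

/-- The memory holds a solution path of coordinate `i`. -/
structure HasPath (D : Scalar) (i : ℕ) (s : Store) : Prop where
  pieces : s.ncell (0, i, 0, 0) = D.T + 2
  path : D.IsPath (D.T + 2) (fun j => s.rcell (2, i, j, 0)) (fun j r => s.rcell (3, i, j, r))

/-- Two memories agree on the output for the coordinates other than `i`. -/
structure SameOutput (i : ℕ) (s s' : Store) : Prop where
  pieces : ∀ i', i' ≠ i → s'.ncell (0, i', 0, 0) = s.ncell (0, i', 0, 0)
  breaks : ∀ i', i' ≠ i → ∀ j, s'.rcell (2, i', j, 0) = s.rcell (2, i', j, 0)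
  values : ∀ i', i' ≠ i → ∀ j r, s'.rcell (3, i', j, r) = s.rcell (3, i', j, r)

theorem run_envelope (hq : D.q = 0 ∨ 1 ≤ D.q) (hle : ∀ r, 1 ≤ r → r ≤ D.T + 1 → D.lo r ≤ D.hi r)
    (h : Env D i s) (hT : HasTable D s) (hN : 3 * D.T + 10 ≤ N) :
    Run D.q N envelope s (fun s' => HasPath D i s' ∧ SameOutput i s s') := by
  refine Run.seq (Run.nput (Run.seq (Run.rput (Run.seq (Run.nset ?_)))))
  -- The breakpoint with index `j`, written last, is the current parameter, and variable 12 the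
  -- current budget.
  refine (Run.for (fun j s' => D.Front (flag s D.endNode) (val s D.endNode) j (s'.nvar 12)
      (s'.rcell (2, i, j, 0)) ∧ s'.rcell (2, i, 0, 0) = 0 ∧
      (∀ j' < j, s'.rcell (2, i, j', 0) ≤ s'.rcell (2, i, j' + 1, 0) ∧
        D.OptimalOn (s'.rcell (2, i, j', 0)) (s'.rcell (2, i, j' + 1, 0))
          (fun r => s'.rcell (3, i, j', r - 1))) ∧
      (∀ i', i' ≠ i → ∀ j, s'.rcell (2, i', j, 0) = s.rcell (2, i', j, 0)) ∧
      (∀ i', i' ≠ i → ∀ j r, s'.rcell (3, i', j, r) = s.rcell (3, i', j, r)))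
    0 (D.T + 2) (by simp) (by omega) (by omega) rfl ?_ (fun s' hF => ?_) ?_).mono ?_
  · simp [h.eqT, h.eqI]
    exact ⟨by simpa using hT.front_zero hq hle, fun i' hi' h => absurd h hi'⟩
  · have : s'.nvar 1 = D.T := (hF.n 1 rfl).trans (by simp [h.eqT])
    simp [this]
  · intro j s₁ _ hj hjv f₁ ⟨hI₁, hI₂, hI₃, hI₄, hI₅⟩
    have e₁ : Env D i s₁ := by
      refine Env.frame ?_ f₁ rfl
      exact ⟨⟨by simpa using h.eqT, by simpa using h.eqI, by simpa using h.lo,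
        by simpa using h.hi⟩, by simpa using h.tm, by simpa using h.ty⟩
    have t₁ : ∀ n k, SameAt s s₁ n k := fun n k =>
      SameAt.trans ⟨by simp, by simp, by simp⟩ (sameAt_of_frame f₁ rfl n k)
    have eflag : flag s₁ D.endNode = flag s D.endNode := by
      funext k; simp only [flag, (t₁ _ k).flag]
    have eval : val s₁ D.endNode = val s D.endNode := by
      funext k; exact (t₁ _ k).val
    have etraj : ∀ k r, traj s₁ D.endNode k r = traj s D.endNode k r := fun k r => (t₁ _ k).traj r
    refine Run.seq ((run_crossing e₁ rfl hI₁.le hN).mono fun s₂ q₂ f₂ => ?_)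
    rw [eflag, eval] at q₂
    have e₂ := e₁.frame f₂ rfl
    obtain ⟨g₁, g₂, g₃⟩ := hI₁.next (hT.antitone hq) q₂
    have hopt := hT.optimalOn hq hI₁.le hI₁.feas g₃
    have h7 : s₂.nvar 7 = j := (f₂.n 7 rfl).trans hjv
    have h12 : s₂.nvar 12 = s₁.nvar 12 := f₂.n 12 rfl
    refine Run.seq (Run.rput ?_)
    have key : ∃ s₃, s₃ = s₂.putR (2, (var 2).eval s₂,
      (NExp.add (var 7) (lit 1)).eval s₂, (lit 0).eval s₂)
      ((rvar 7).eval D.q s₂) := ⟨_, rfl⟩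
    obtain ⟨s₃, hs₃⟩ := key
    rw [← hs₃]
    have f₃ : Frame (.rput 2 (var 2) (.add (var 7) (lit 1))
      (lit 0) (rvar 7)) s₂ s₃ :=
      hs₃ ▸ (Exec.rput (q := D.q) 2 _ _ _ _ s₂).frame
    have e₃ := e₂.frame f₃ rfl
    refine Run.seq ((run_output (k := s₁.nvar 12) (j := j) e₃ ((f₃.n 12 rfl).trans h12)
      ((f₃.n 7 rfl).trans h7) hN).mono fun s₄ ⟨c₁, c₂⟩ f₄ => Run.nset ?_)
    have hbr : ∀ i' j', s₄.rcell (2, i', j', 0) =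
        if i' = i ∧ j' = j + 1 then s₂.rvar 7 else s₁.rcell (2, i', j', 0) := by
      intro i' j'
      rw [f₄.rc 2 rfl, hs₃, ← f₂.rc 2 rfl (i', j', 0)]
      simp [e₂.eqI, h7]
    have hx : ∀ i' j' r, i' ≠ i ∨ j' ≠ j → s₄.rcell (3, i', j', r) = s₁.rcell (3, i', j', r) :=
      fun i' j' r hne => by rw [c₂ i' j' r hne, f₃.rc 3 rfl, f₂.rc 3 rfl]
    have hx' : ∀ r < D.T + 1, s₄.rcell (3, i, j, r) =
        traj s D.endNode (s₁.nvar 12) (r + 1) := fun r hr => by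
      rw [c₁ r hr, ← etraj, traj, f₃.rc 5 rfl, f₂.rc 5 rfl, traj]
    have h13 : s₄.nvar 13 = s₂.nvar 13 := (f₄.n 13 rfl).trans (f₃.n 13 rfl)
    simp only [Store.setN_rcell, Store.setN_nvar]
    refine ⟨?_, ?_, fun j' hj' => ?_, fun i' hi' j' => ?_, fun i' hi' j' r => ?_⟩
    · have : s₄.rcell (2, i, j + 1, 0) = s₂.rvar 7 := by rw [hbr, if_pos ⟨rfl, rfl⟩]
      rw [this]
      simp [h13]
      exact g₂
    · rw [hbr, if_neg (by omega), hI₂]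
    · rw [hbr, hbr, if_neg (by omega)]
      rcases Nat.lt_or_ge j' j with hlt | hge
      · rw [if_neg (by omega)]
        refine ⟨(hI₃ j' hlt).1, (hI₃ j' hlt).2.congr fun r _ _ => ?_⟩
        rw [hx _ _ _ (Or.inr (by omega))]
      · rw [show j' = j by omega, if_pos ⟨rfl, rfl⟩]
        refine ⟨g₁, hopt.congr fun r a b => ?_⟩
        rw [hx' _ (by omega), show r - 1 + 1 = r by omega]
    · rw [hbr, if_neg (by tauto), hI₄ i' hi']
    · rw [hx _ _ _ (Or.inl hi'), hI₅ i' hi']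
  · intro s' ⟨a₁, a₂, a₃, a₄, a₅⟩ f
    have hnc : ∀ i', s'.ncell (0, i', 0, 0) =
        if i' = i then D.T + 2 else s.ncell (0, i', 0, 0) := fun i' => by
      rw [f.nc 0 rfl]
      simp [h.eqI, h.eqT]
    refine ⟨⟨by rw [hnc, if_pos rfl], a₂, ?_, fun j hj => (a₃ j hj).1, fun j hj => (a₃ j hj).2⟩,
      fun i' hi' => by rw [hnc, if_neg hi'], a₄, a₅⟩
    -- After `T + 2` pieces the budget cannot have dropped each time, so the last breakpoint is 1;
    -- pieces after the first arrival at 1 are single points.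
    rcases a₁.progress with h₁ | h₁
    · omega
    · exact h₁.1

theorem run_coordinate (hq : D.q = 0 ∨ 1 ≤ D.q)
    (hle : ∀ r, 1 ≤ r → r ≤ D.T + 1 → D.lo r ≤ D.hi r) (h : Input D i s)
    (hN : 3 * D.T + 10 ≤ N) :
    Run D.q N coordinate s (fun s' => HasPath D i s' ∧ SameOutput i s s') := by
  refine Run.seq ((run_nodes h (by omega)).mono fun s₁ e₁ f₁ => ?_)
  refine Run.seq ((run_table hq e₁ hN).mono fun s₂ q₂ f₂ => ?_)
  refine (run_envelope hq hle (e₁.frame f₂ rfl) q₂ hN).mono fun s₃ ⟨a, b⟩ _ => ⟨a, ?_⟩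
  exact ⟨fun i' hi' => by rw [b.pieces i' hi', f₂.nc 0 rfl, f₁.nc 0 rfl],
    fun i' hi' j => by rw [b.breaks i' hi', f₂.rc 2 rfl, f₁.rc 2 rfl],
    fun i' hi' j r => by rw [b.values i' hi', f₂.rc 3 rfl, f₁.rc 3 rfl]⟩

/-- Outside the time range the memory is zero, in agreement with the default value in `coord`, so
the bounds match at every index. -/
theorem input_coord {p T : ℕ} (q : ℝ) (F : Fin (T + 1) → Fin p → ℝ) (lam : Fin (T + 1) → ℝ)
    (i : Fin p) {s : Store} (hT : s.nvar 1 = T) (hi : s.nvar 2 = i)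
    (h₀ : ∀ x, s.rcell (0, x) = (input F lam).rcell (0, x))
    (h₁ : ∀ x, s.rcell (1, x) = (input F lam).rcell (1, x)) : Input (coord q F lam i) i s := by
  refine ⟨hT, hi, fun r => ?_, fun r => ?_⟩
  all_goals
    rw [h₀, h₁]
    by_cases h : r - 1 < T + 1
    · simp only [input, coord, dif_pos h, dif_pos (And.intro h i.2)]
    · simp only [input, coord, dif_neg h, dif_neg (fun h' => h (And.left h'))]
      simp

/-- Processing a coordinate requires only its inputs in the memory, so remains of earlier tables do
no harm; finished outputs survive by `SameOutput`. -/
theorem exec_main {q : ℝ} (hq : q = 0 ∨ 1 ≤ q) {p T : ℕ} (F : Fin (T + 1) → Fin p → ℝ)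
    (lam : Fin (T + 1) → ℝ) (hlam : ∀ t, 0 ≤ lam t) :
    ∃ n s, Exec q main (input F lam) n s ∧
      n ≤ 11 + p * (9 + coordinate.bound (3 * T + 10)) ∧
      ∀ i : Fin p, HasPath (coord q F lam i) i s := by
  obtain ⟨n, s, he, hn, hI⟩ := exec_for (q := q) (v := 2) (lo := lit 0)
    (hi := var 0) (P := coordinate) (c := coordinate.bound (3 * T + 10))
    (s := input F lam) (fun b s' => ∀ i : Fin p, i < b → HasPath (coord q F lam i) i s')
    0 p rfl (by omega) (by simp) (fun s' hF => hF.n 0 rfl)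
    (fun k s' _ hk hkv hF hI => by
      have hin : Input (coord q F lam ⟨k, hk⟩) k s' :=
        input_coord q F lam ⟨k, hk⟩ (hF.n 1 rfl) hkv (hF.rc 0 rfl) (hF.rc 1 rfl)
      have hle : ∀ r, 1 ≤ r → r ≤ T + 1 →
          (coord q F lam ⟨k, hk⟩).lo r ≤ (coord q F lam ⟨k, hk⟩).hi r := by
        intro r h₁ h₂
        have hr : r - 1 < T + 1 := by omega
        simp only [coord, dif_pos hr]
        linarith [hlam ⟨r - 1, hr⟩]
      obtain ⟨n, s'', he, hn, ⟨a, b⟩, f⟩ :=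
        (run_coordinate (D := coord q F lam ⟨k, hk⟩) (N := 3 * T + 10) hq hle hin le_rfl).frame
      refine ⟨n, s'', he, hn, (f.n 2 rfl).trans hkv, fun i hi => ?_⟩
      rcases Nat.lt_or_ge i k with hik | hik
      · have hne : (i : ℕ) ≠ k := by omega
        have := hI i hik
        refine ⟨(b.pieces i hne).trans this.pieces, ?_⟩
        have hp := this.path
        simp only [← b.breaks i hne, ← b.values i hne] at hp
        exact hp
      · have : i = ⟨k, hk⟩ := Fin.ext (by simp; omega)
        subst this
        exact ⟨a.pieces, a.path⟩)
  refine ⟨n, s, he, hn.trans ?_, fun i => hI i i.2⟩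
  simp only [NExp.cost, lit, var]
  rw [Nat.sub_zero, show 1 + coordinate.bound (3 * T + 10) + 8 =
    9 + coordinate.bound (3 * T + 10) by omega]
  omega

/-- With `3 * T + 10 ≤ 13 * max 1 T`, depth three gives the factor `13 ^ 3 = 2197`; the 20 is `11 +
9`, the overhead of the outer loop. -/
theorem bound_coordinate (p T : ℕ) : 11 + p * (9 + coordinate.bound (3 * T + 10)) ≤
    (20 + 2197 * coordinate.bound 1) * (max 1 p * max 1 T ^ 3) := by
  have h₁ := Prog.bound_le (N := 3 * T + 10) (by omega) coordinate
  rw [show coordinate.depth = 3 from rfl] at h₁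
  generalize coordinate.bound 1 = B at *
  generalize coordinate.bound (3 * T + 10) = A at *
  have h₂ : (3 * T + 10) ^ 3 ≤ (13 * max 1 T) ^ 3 := Nat.pow_le_pow_left (by omega) 3
  have h₃ : 1 ≤ max 1 T ^ 3 := Nat.one_le_pow _ _ (by omega)
  have h₄ : A ≤ B * (2197 * max 1 T ^ 3) :=
    h₁.trans (Nat.mul_le_mul_left B (h₂.trans (le_of_eq (by ring))))
  have h₅ : 1 ≤ max 1 p := le_max_left _ _
  generalize max 1 T ^ 3 = M at *
  calc 11 + p * (9 + A) ≤ 11 * (max 1 p * M) + max 1 p * (9 * M + B * (2197 * M)) := by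
        have : 1 ≤ max 1 p * M := Nat.mul_pos h₅ h₃
        exact Nat.add_le_add (by omega) (Nat.mul_le_mul (le_max_right _ _) (by omega))
    _ = _ := by ring

end Program

end ProxGL

theorem theorem1 :
    ∃ (P : RealRAM.Prog) (C : ℕ), ∀ q : ℝ, (q = 0 ∨ 1 ≤ q) →
      ∀ (p T : ℕ) (F : Fin (T + 1) → Fin p → ℝ) (lam : Fin (T + 1) → ℝ), (∀ t, 0 ≤ lam t) →
        ∃ (n : ℕ) (s : RealRAM.Store),
          RealRAM.Exec q P (ProxGL.input F lam) n s ∧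
          n ≤ C * (max 1 p * max 1 T ^ 3) ∧
          ProxGL.IsSolutionPath q F lam (ProxGL.outPieces p s) (ProxGL.outBreaks p s)
            (ProxGL.outValues p T s) := by
  refine ⟨ProxGL.Program.main, 20 + 2197 * ProxGL.Program.coordinate.bound 1, ?_⟩
  intro q hq p T F lam hlam
  obtain ⟨n, s, he, hn, h⟩ := ProxGL.Program.exec_main hq F lam hlam
  refine ⟨n, s, he, hn.trans (ProxGL.Program.bound_coordinate p T), ?_⟩
  refine ProxGL.isSolutionPath_of_coord hlam (x := fun i j r => s.rcell (3, i, j, r)) fun i => ?_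
  have := (h i).path
  rw [← (h i).pieces] at this
  exact this
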